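/- Notation. For $\sigma>0$ and $1\le p\le\infty$ let $PW^p_\sigma$ be the space of all functions $f(z)=\frac1{2\pi}\int_{-\sigma}^{\sigma}\hat f(\omega)e^{i\omega z}\,d\omega$, $z\in\mathbb C$, with $\hat f\in L^p([-\sigma,\sigma])$, normed by $\|f\|_{PW^p_\sigma}=\|\hat f\|_{L^p([-\sigma,\sigma])}$, where $L^p([-\sigma,\sigma])$ is taken with respect to the normalized measure $d\omega/(2\sigma)$. The space $PW^2_\pi$ is a Hilbert space with $\langle f,g\rangle=\int_{\mathbb R}f(t)\overline{g(t)}\,dt=\frac1{2\pi}\int_{-\pi}^{\pi}\hat f(\omega)\overline{\hat g(\omega)}\,d\omega$. A stable LTI system is a bounded linear operator $H:PW^1_\pi\to PW^1_\pi$, with operator norm $\|H\|$, that commutes with all translations $f\mapsto f(\cdot-a)$, $a\in\mathbb R$. Theorem. Let $0<\beta<1$. There exists an orthonormal basis $\{s_n\}_{n\in\mathbb N}$ of $PW^2_\pi$ with the following properties. (i) The measurement functionals $\gamma_n(f)=\frac1{2\pi}\int_{-\pi}^{\pi}\hat f(\omega)\overline{\hat s_n(\omega)}\,d\omega$ are uniformly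 bounded on $PW^1_\pi$: there is a constant $C_\gamma>0$ such that $\|\hat s_n\|_{L^\infty([-\pi,\pi])}\le C_\gamma$ and $|\gamma_n(f)|\le C_\gamma\|f\|_{PW^1_\pi}$ for all $n\in\mathbb N$ and $f\in PW^1_\pi$. (ii) For every stable LTI system $H:PW^1_\pi\to PW^1_\pi$ and every $f\in PW^1_{\beta\pi}$, $$\lim_{N\to\infty}\ \sup_{t\in\mathbb R}\Big|(Hf)(t)-\sum_{n=1}^{N}\gamma_n(f)\,(Hs_n)(t)\Big|=0 .$$ (iii) There is a constant $C_s>0$ such that for every stable LTI system $H$, every $f\in PW^1_{\beta\pi}$ and every $N$, $$\sup_{t\in\mathbb R}\Big|\sum_{n=1}^{N}\gamma_n(f)\,(Hs_n)(t)\Big|\le C_s\,\|H\|\,\|f\|_{PW^1_\pi}.$$ -/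

import Mathlib

open MeasureTheory Filter Topology
open scoped ENNReal FourierTransform

namespace PaleyWiener

/-- The normalised Lebesgue measure `dω / (2σ)` on `[-σ, σ]`. The `L^p` spaces on the band
`[-σ, σ]` are taken with respect to it, so that `‖g‖_p^p = (1 / 2σ) ∫_{-σ}^{σ} |g|^p` for
`p < ∞`, and `‖g‖_∞` is the essential supremum of `|g|` on `[-σ, σ]`. -/
noncomputable def bandMeasure (σ : ℝ) : Measure ℝ :=
  (ENNReal.ofReal (2 * σ))⁻¹ • volume.restrict (Set.Icc (-σ) σ)

/-- The entire function `f(z) = (1 / 2π) ∫_{-σ}^{σ} g(ω) e^{iωz} dω`. -/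
noncomputable def synthesis (σ : ℝ) (g : ℝ → ℂ) (z : ℂ) : ℂ :=
  1 / (2 * (Real.pi : ℂ)) *
    ∫ ω in Set.Icc (-σ) σ, g ω * Complex.exp (Complex.I * (ω : ℂ) * z)

/-! ### The band measure -/

theorem restrict_eq_zero {σ : ℝ} (h : σ ≤ 0) : volume.restrict (Set.Icc (-σ) σ) = 0 := by
  rw [Measure.restrict_eq_zero, Real.volume_Icc]
  simp; linarith

theorem ae_restrict_of_ae_bandMeasure {σ : ℝ} {P : ℝ → Prop}
    (h : ∀ᵐ x ∂(bandMeasure σ), P x) : ∀ᵐ x ∂(volume.restrict (Set.Icc (-σ) σ)), P x := by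
  refine Measure.AbsolutelyContinuous.ae_le ?_ h
  unfold bandMeasure
  exact Measure.absolutelyContinuous_smul (ENNReal.inv_ne_zero.2 ENNReal.ofReal_ne_top)

theorem ae_bandMeasure_of_ae_restrict {σ : ℝ} {P : ℝ → Prop}
    (h : ∀ᵐ x ∂(volume.restrict (Set.Icc (-σ) σ)), P x) : ∀ᵐ x ∂(bandMeasure σ), P x := by
  unfold bandMeasure
  exact Measure.ae_smul_measure h _

instance instIsFiniteMeasureBandMeasure (σ : ℝ) : IsFiniteMeasure (bandMeasure σ) := by
  constructor
  unfold bandMeasure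
  rcases le_or_gt σ 0 with h | h
  · simp [restrict_eq_zero h]
  · simp only [Measure.smul_apply, smul_eq_mul]
    refine ENNReal.mul_lt_top ?_ (by simp)
    simp [h]

theorem integrableOn_of_memLp {p : ℝ≥0∞} [hp : Fact (1 ≤ p)] {σ : ℝ} {g : ℝ → ℂ}
    (hg : MemLp g p (bandMeasure σ)) : IntegrableOn g (Set.Icc (-σ) σ) := by
  have h1 : Integrable g (bandMeasure σ) := hg.integrable hp.out
  rcases le_or_gt σ 0 with h | h
  · simp [IntegrableOn, restrict_eq_zero h]
  · unfold bandMeasure at h1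
    rwa [integrable_smul_measure (ENNReal.inv_ne_zero.2 ENNReal.ofReal_ne_top) (by simp [h])] at h1

theorem integrableOn_mul_exp {σ : ℝ} {g : ℝ → ℂ} (hg : IntegrableOn g (Set.Icc (-σ) σ)) (z : ℂ) :
    IntegrableOn (fun ω : ℝ => g ω * Complex.exp (Complex.I * (ω : ℂ) * z))
      (Set.Icc (-σ) σ) :=
  hg.mul_continuousOn (by fun_prop) isCompact_Icc

/-! ### Uniqueness of the spectrum, and Parseval's formula -/

theorem synthesis_ofReal (σ : ℝ) (g : ℝ → ℂ) (t : ℝ) :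
    synthesis σ g t = 1 / (2 * (Real.pi : ℂ)) *
      𝓕⁻ ((Set.Icc (-σ) σ).indicator g) (t / (2 * Real.pi)) := by
  unfold synthesis
  rw [Real.fourierInv_eq', ← integral_indicator measurableSet_Icc]
  congr 1
  refine integral_congr_ae (Eventually.of_forall fun x => ?_)
  by_cases hx : x ∈ Set.Icc (-σ) σ
  · simp only [Set.indicator_of_mem hx, smul_eq_mul]
    rw [mul_comm]
    congr 2
    have : (Real.pi : ℂ) ≠ 0 := by exact_mod_cast Real.pi_ne_zero
    simp
    field_simp
  · simp [Set.indicator_of_notMem hx]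

theorem integral_schwartz_fourierInv_mul {G : ℝ → ℂ} (hG : Integrable G) (φ : SchwartzMap ℝ ℂ) :
    ∫ x, (𝓕⁻ φ : SchwartzMap ℝ ℂ) x * G x = ∫ x, φ x * 𝓕⁻ G x := by
  have h := VectorFourier.integral_bilin_fourierIntegral_eq_flip (ContinuousLinearMap.mul ℂ ℂ)
    (μ := volume) (ν := volume) (L := -innerₗ ℝ) Real.continuous_fourierChar
    (continuous_inner (𝕜 := ℝ) (E := ℝ)).neg φ.integrable hG
  have e : (-innerₗ ℝ : ℝ →ₗ[ℝ] ℝ →ₗ[ℝ] ℝ).flip = -innerₗ ℝ := by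
    ext; simp
  rw [e] at h
  rw [SchwartzMap.fourierInv_coe]
  exact h

theorem ae_eq_of_forall_schwartz {F G : ℝ → ℂ} (hF : LocallyIntegrable F)
    (hG : LocallyIntegrable G)
    (h : ∀ ψ : SchwartzMap ℝ ℂ, ∫ x, ψ x * F x = ∫ x, ψ x * G x) : F =ᵐ[volume] G := by
  refine ae_eq_of_integral_contDiff_smul_eq hF hG fun g hg hgs => ?_
  have hs : HasCompactSupport (fun x => (g x : ℂ)) :=
    hgs.comp_left (g := fun x : ℝ => (x : ℂ)) (by simp)
  have hd : ContDiff ℝ ((⊤ : ℕ∞) : WithTop ℕ∞) (fun x => (g x : ℂ)) :=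
    Complex.ofRealCLM.contDiff.comp hg
  simpa using h (hs.toSchwartzMap hd)

theorem ae_eq_zero_of_fourierInv_eq_zero {G : ℝ → ℂ} (hG : Integrable G)
    (h : ∀ x, 𝓕⁻ G x = 0) : G =ᵐ[volume] 0 := by
  refine ae_eq_of_forall_schwartz hG.locallyIntegrable
    (integrable_zero _ _ _).locallyIntegrable fun ψ => ?_
  have := integral_schwartz_fourierInv_mul hG (𝓕 ψ)
  rw [FourierTransform.fourierInv_fourier_eq] at this
  simpa [h] using this

theorem ae_eq_of_synthesis_eq {σ : ℝ} {g₁ g₂ : ℝ → ℂ} (h₁ : IntegrableOn g₁ (Set.Icc (-σ) σ))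
    (h₂ : IntegrableOn g₂ (Set.Icc (-σ) σ)) (h : synthesis σ g₁ = synthesis σ g₂) :
    g₁ =ᵐ[bandMeasure σ] g₂ := by
  have h0 : (Set.Icc (-σ) σ).indicator (g₁ - g₂) =ᵐ[volume] 0 := by
    refine ae_eq_zero_of_fourierInv_eq_zero
      ((integrable_indicator_iff measurableSet_Icc).2 (h₁.sub h₂)) fun x => ?_
    have hpi : (Real.pi : ℂ) ≠ 0 := by exact_mod_cast Real.pi_ne_zero
    have e : synthesis σ (g₁ - g₂) ((x * (2 * Real.pi) : ℝ) : ℂ) = 0 := by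
      have h3 := congrFun h ((x * (2 * Real.pi) : ℝ) : ℂ)
      unfold synthesis at h3 ⊢
      simp only [Pi.sub_apply, sub_mul]
      rw [integral_sub (integrableOn_mul_exp h₁ _) (integrableOn_mul_exp h₂ _), mul_sub, h3,
        sub_self]
    rw [synthesis_ofReal, mul_div_cancel_right₀ _ (by positivity)] at e
    simpa [hpi] using e
  refine ae_bandMeasure_of_ae_restrict ((ae_restrict_iff' measurableSet_Icc).2 ?_)
  filter_upwards [h0] with x hx hm
  rw [Set.indicator_of_mem hm] at hx
  simpa [sub_eq_zero] using hx

theorem fourierInv_toLp_ae_eq {G : ℝ → ℂ} (hG : Integrable G) (hG2 : MemLp G 2) :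
    (𝓕⁻ (hG2.toLp G) : Lp ℂ 2 (volume : Measure ℝ)) =ᵐ[volume] 𝓕⁻ G := by
  have hc : Continuous (𝓕⁻ G) := by
    have := VectorFourier.fourierIntegral_continuous (μ := volume) (L := -innerₗ ℝ)
      Real.continuous_fourierChar
      (continuous_inner (𝕜 := ℝ) (E := ℝ)).neg hG
    exact this
  refine ae_eq_of_forall_schwartz ((Lp.memLp _).locallyIntegrable (by norm_num))
    hc.locallyIntegrable fun ψ => ?_
  have h1 := Lp.fourierInv_toTemperedDistribution_eq (hG2.toLp G)
  have h2 := congrArg (fun T => T ψ) h1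
  simp only [TemperedDistribution.fourierInv_apply, Lp.toTemperedDistribution_apply,
    smul_eq_mul] at h2
  rw [← h2, ← integral_schwartz_fourierInv_mul hG]
  refine integral_congr_ae ?_
  filter_upwards [hG2.coeFn_toLp] with x hx
  rw [hx]

theorem integral_conj_fourierInv_mul {F G : ℝ → ℂ} (hF : Integrable F) (hF2 : MemLp F 2)
    (hG : Integrable G) (hG2 : MemLp G 2) :
    ∫ x, 𝓕⁻ G x * starRingEnd ℂ (𝓕⁻ F x) = ∫ x, G x * starRingEnd ℂ (F x) := by
  have h := (Lp.fourierTransformₗᵢ ℝ ℂ).symm.inner_map_map (hF2.toLp F) (hG2.toLp G)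
  rw [L2.inner_def, L2.inner_def] at h
  calc _ = _ := integral_congr_ae ?_
    _ = _ := h
    _ = _ := integral_congr_ae ?_
  · filter_upwards [fourierInv_toLp_ae_eq hF hF2, fourierInv_toLp_ae_eq hG hG2] with x h1 h2
    rw [← h1, ← h2]; rfl
  · filter_upwards [hF2.coeFn_toLp, hG2.coeFn_toLp] with x h1 h2
    rw [h1, h2]; rfl

/-! ### The Paley–Wiener spaces -/

theorem synthesis_add {σ : ℝ} {g₁ g₂ : ℝ → ℂ} (h₁ : IntegrableOn g₁ (Set.Icc (-σ) σ))
    (h₂ : IntegrableOn g₂ (Set.Icc (-σ) σ)) :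
    synthesis σ (g₁ + g₂) = synthesis σ g₁ + synthesis σ g₂ := by
  funext z
  simp only [synthesis, Pi.add_apply, add_mul]
  rw [integral_add (integrableOn_mul_exp h₁ _) (integrableOn_mul_exp h₂ _), mul_add]

theorem synthesis_smul {σ : ℝ} (c : ℂ) (g : ℝ → ℂ) :
    synthesis σ (c • g) = c • synthesis σ g := by
  funext z
  simp only [synthesis, Pi.smul_apply, smul_eq_mul, mul_assoc c]
  rw [integral_const_mul]
  ring

/-- The Paley–Wiener space `PW^p_σ` as a space of functions on `ℂ`: all `f` of the form
`f(z) = (1 / 2π) ∫_{-σ}^{σ} g(ω) e^{iωz} dω` with `g ∈ L^p([-σ, σ])`. -/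
noncomputable def functions (p : ℝ≥0∞) [Fact (1 ≤ p)] (σ : ℝ) : Submodule ℂ (ℂ → ℂ) where
  carrier := {f | ∃ g : ℝ → ℂ, MemLp g p (bandMeasure σ) ∧ f = synthesis σ g}
  add_mem' := by
    rintro _ _ ⟨g₁, h₁, rfl⟩ ⟨g₂, h₂, rfl⟩
    exact ⟨g₁ + g₂, h₁.add h₂,
      (synthesis_add (integrableOn_of_memLp h₁) (integrableOn_of_memLp h₂)).symm⟩
  zero_mem' := ⟨0, MemLp.zero, by funext z; simp [synthesis]⟩
  smul_mem' := by
    rintro c _ ⟨g, h, rfl⟩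
    exact ⟨c • g, h.const_smul c, (synthesis_smul c g).symm⟩

/-- The Paley–Wiener space `PW^p_σ`, with the norm `‖f‖ = ‖f̂‖_{L^p([-σ, σ])}` defined below. -/
def PW (p : ℝ≥0∞) [Fact (1 ≤ p)] (σ : ℝ) : Type := functions p σ

namespace PW

variable {p : ℝ≥0∞} [Fact (1 ≤ p)] {σ : ℝ}

noncomputable instance instAddCommGroup : AddCommGroup (PW p σ) :=
  inferInstanceAs (AddCommGroup (functions p σ))

noncomputable instance instModule : Module ℂ (PW p σ) :=
  inferInstanceAs (Module ℂ (functions p σ))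

instance instCoeFun : CoeFun (PW p σ) (fun _ => ℂ → ℂ) := ⟨fun f => f.1⟩

theorem coe_add (f g : PW p σ) : ((f + g : PW p σ) : ℂ → ℂ) = (f : ℂ → ℂ) + g := rfl

theorem coe_smul (c : ℂ) (f : PW p σ) : ((c • f : PW p σ) : ℂ → ℂ) = c • (f : ℂ → ℂ) := rfl

/-- The spectrum `f̂ ∈ L^p([-σ, σ])` of `f ∈ PW^p_σ`. -/
noncomputable def hat (f : PW p σ) : Lp ℂ p (bandMeasure σ) :=
  (Classical.choose_spec f.2).1.toLp (Classical.choose f.2)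

theorem hat_ae_eq_choose (f : PW p σ) : f.hat =ᵐ[bandMeasure σ] Classical.choose f.2 :=
  MemLp.coeFn_toLp _

theorem synthesis_congr {g₁ g₂ : ℝ → ℂ} (h : g₁ =ᵐ[bandMeasure σ] g₂) :
    synthesis σ g₁ = synthesis σ g₂ := by
  funext z
  unfold synthesis
  congr 1
  refine integral_congr_ae ?_
  filter_upwards [ae_restrict_of_ae_bandMeasure h] with x hx
  rw [hx]

theorem synthesis_hat (f : PW p σ) : synthesis σ f.hat = f :=
  (synthesis_congr (hat_ae_eq_choose f)).trans (Classical.choose_spec f.2).2.symm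

/-- The spectrum is the only `L^p` function that represents `f`. -/
theorem hat_eq_of_synthesis_eq {f : PW p σ} {g : Lp ℂ p (bandMeasure σ)}
    (h : synthesis σ g = f) : f.hat = g :=
  Lp.ext (ae_eq_of_synthesis_eq (integrableOn_of_memLp (Lp.memLp _))
    (integrableOn_of_memLp (Lp.memLp _)) ((synthesis_hat f).trans h.symm))

/-- The spectrum as a linear map. -/
noncomputable def hatₗ : PW p σ →ₗ[ℂ] Lp ℂ p (bandMeasure σ) where
  toFun := hat
  map_add' f g := hat_eq_of_synthesis_eq <| by
    rw [synthesis_congr (Lp.coeFn_add _ _), synthesis_add (integrableOn_of_memLp (Lp.memLp _))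
      (integrableOn_of_memLp (Lp.memLp _)), synthesis_hat, synthesis_hat, coe_add]
  map_smul' c f := hat_eq_of_synthesis_eq <| by
    rw [synthesis_congr (Lp.coeFn_smul _ _), synthesis_smul, synthesis_hat, coe_smul]
    rfl

theorem hatₗ_injective : Function.Injective (hatₗ : PW p σ →ₗ[ℂ] _) := by
  intro f g h
  have h' : f.hat = g.hat := h
  exact Subtype.ext (by rw [← synthesis_hat f, ← synthesis_hat g, h'])

noncomputable instance instNormedAddCommGroup : NormedAddCommGroup (PW p σ) :=
  NormedAddCommGroup.induced (PW p σ) (Lp ℂ p (bandMeasure σ)) hatₗ hatₗ_injective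

theorem norm_def (f : PW p σ) : ‖f‖ = ‖f.hat‖ := rfl

noncomputable instance instNormedSpace : NormedSpace ℂ (PW p σ) where
  norm_smul_le c f := by
    change ‖hatₗ (c • f)‖ ≤ ‖c‖ * ‖hatₗ f‖
    rw [map_smul]
    exact norm_smul_le c (hatₗ f)

/-- The inner product of `PW^2_π`, in the form `⟨f, g⟩ = (1 / 2π) ∫_{-π}^{π} f̂ · conj ĝ`. (As
everywhere in Mathlib, `inner ℂ g f` is linear in `f`.) It is equal to `∫_ℝ f(t) conj g(t) dt`
by `inner_eq_integral` below. -/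
noncomputable instance instInnerProductSpace : InnerProductSpace ℂ (PW 2 Real.pi) where
  inner g f := inner ℂ g.hat f.hat
  norm_sq_eq_re_inner f := norm_sq_eq_re_inner (𝕜 := ℂ) f.hat
  conj_inner_symm f g := inner_conj_symm f.hat g.hat
  add_left f g h := by
    change inner ℂ (hatₗ (f + g)) (hatₗ h) = _
    rw [map_add, inner_add_left]
    rfl
  smul_left f g c := by
    change inner ℂ (hatₗ (c • f)) (hatₗ g) = _
    rw [map_smul, inner_smul_left]
    rfl

theorem inner_def (g f : PW 2 Real.pi) : inner ℂ g f = inner ℂ g.hat f.hat := rfl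

theorem integral_bandMeasure_pi (F : ℝ → ℂ) :
    ∫ ω, F ω ∂(bandMeasure Real.pi) =
      1 / (2 * (Real.pi : ℂ)) * ∫ ω in Set.Icc (-Real.pi) Real.pi, F ω := by
  have : (0 : ℝ) ≤ 2 * Real.pi := by positivity
  rw [bandMeasure, integral_smul_measure, ENNReal.toReal_inv, ENNReal.toReal_ofReal this]
  rw [Complex.real_smul]
  simp

/-- Parseval's formula: `⟨f, g⟩ = ∫_ℝ f(t) conj g(t) dt` on `PW^2_π`. -/
theorem inner_eq_integral (g f : PW 2 Real.pi) :
    inner ℂ g f = ∫ t : ℝ, f t * starRingEnd ℂ (g t) := by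
  have hi (f : PW 2 Real.pi) :
      Integrable ((Set.Icc (-Real.pi) Real.pi).indicator f.hat) :=
    (integrable_indicator_iff measurableSet_Icc).2 (integrableOn_of_memLp (Lp.memLp _))
  have hi2 (f : PW 2 Real.pi) :
      MemLp ((Set.Icc (-Real.pi) Real.pi).indicator f.hat) 2 := by
    refine (memLp_indicator_iff_restrict measurableSet_Icc).2 ?_
    have hc : ENNReal.ofReal (2 * Real.pi) ≠ 0 := by simp [Real.pi_pos]
    refine (Lp.memLp f.hat).of_measure_le_smul (c := ENNReal.ofReal (2 * Real.pi))
      ENNReal.ofReal_ne_top (le_of_eq ?_)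
    rw [bandMeasure, smul_smul, ENNReal.mul_inv_cancel hc ENNReal.ofReal_ne_top, one_smul]
  have hpi : (Real.pi : ℂ) ≠ 0 := by exact_mod_cast Real.pi_ne_zero
  have h := integral_conj_fourierInv_mul (hi g) (hi2 g) (hi f) (hi2 f)
  have hr (F : ℝ → ℂ) : ∫ x in Set.Icc (-Real.pi) Real.pi, F x =
      ∫ x, (Set.Icc (-Real.pi) Real.pi).indicator F x :=
    (integral_indicator measurableSet_Icc).symm
  rw [inner_def, L2.inner_def, integral_bandMeasure_pi, hr]
  set K : ℝ → ℂ := fun u => 𝓕⁻ ((Set.Icc (-Real.pi) Real.pi).indicator f.hat) u *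
    starRingEnd ℂ (𝓕⁻ ((Set.Icc (-Real.pi) Real.pi).indicator g.hat) u) with hK
  have hs : ∀ t : ℝ, f t * starRingEnd ℂ (g t) =
      (1 / (2 * (Real.pi : ℂ))) ^ 2 * K (t / (2 * Real.pi)) := by
    intro t
    have h2 : starRingEnd ℂ (1 / (2 * (Real.pi : ℂ))) = 1 / (2 * (Real.pi : ℂ)) := by
      rw [map_div₀, map_mul, Complex.conj_ofReal, map_ofNat, map_one]
    rw [← synthesis_hat f, ← synthesis_hat g, synthesis_ofReal, synthesis_ofReal, map_mul, h2, hK]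
    ring
  rw [integral_congr_ae (Eventually.of_forall hs), integral_const_mul,
    Measure.integral_comp_div K, h, abs_of_pos (by positivity), Complex.real_smul]
  have hind : ∀ x, (Set.Icc (-Real.pi) Real.pi).indicator (fun ω => inner ℂ (g.hat ω) (f.hat ω)) x
      = (Set.Icc (-Real.pi) Real.pi).indicator f.hat x *
        starRingEnd ℂ ((Set.Icc (-Real.pi) Real.pi).indicator g.hat x) := by
    intro x
    by_cases hx : x ∈ Set.Icc (-Real.pi) Real.pi
    · simp [Set.indicator_of_mem hx]
    · simp [Set.indicator_of_notMem hx]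
  simp_rw [hind]
  push_cast
  field_simp

/-- The translate `(T_a f)(z) = f(z - a)` of `f ∈ PW^p_σ` by `a ∈ ℝ`. -/
noncomputable def translate (a : ℝ) (f : PW p σ) : PW p σ :=
  ⟨fun z => f (z - a), by
    refine ⟨fun ω => f.hat ω * Complex.exp (-(Complex.I * ω * a)), ?_, ?_⟩
    · refine (Lp.memLp f.hat).of_le
        ((Lp.aestronglyMeasurable _).mul (Continuous.aestronglyMeasurable (by fun_prop)))
        (Eventually.of_forall fun ω => ?_)
      rw [norm_mul, Complex.norm_exp]
      simp
    · funext z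
      rw [← synthesis_hat f]
      unfold synthesis
      congr 1
      refine integral_congr_ae (Eventually.of_forall fun ω => ?_)
      simp only [mul_assoc, ← Complex.exp_add]
      congr 2
      ring⟩

theorem translate_apply (a : ℝ) (f : PW p σ) (z : ℂ) : translate a f z = f (z - a) := rfl

/-- The inclusion `PW^2_π ⊆ PW^1_π`. -/
noncomputable def toPW1 (f : PW 2 Real.pi) : PW 1 Real.pi :=
  ⟨f, f.hat, (Lp.memLp f.hat).mono_exponent (by norm_num), (synthesis_hat f).symm⟩

theorem toPW1_apply (f : PW 2 Real.pi) (z : ℂ) : f.toPW1 z = f z := rfl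

/-- The measurement functional `γ(f) = ⟨f, s⟩ = (1 / 2π) ∫_{-π}^{π} f̂(ω) conj ŝ(ω) dω` on
`PW^1_π` that belongs to `s ∈ PW^2_π`. The integral converges for every `f ∈ PW^1_π` as soon as
`ŝ` is essentially bounded. -/
noncomputable def measurement (s : PW 2 Real.pi) (f : PW 1 Real.pi) : ℂ :=
  1 / (2 * (Real.pi : ℂ)) *
    ∫ ω in Set.Icc (-Real.pi) Real.pi, f.hat ω * starRingEnd ℂ (s.hat ω)

/-- On `PW^2_π` the measurement functional is the inner product with `s`. -/
theorem measurement_toPW1 (s f : PW 2 Real.pi) : measurement s f.toPW1 = inner ℂ s f := by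
  have h : f.toPW1.hat =ᵐ[bandMeasure Real.pi] f.hat :=
    ae_eq_of_synthesis_eq (integrableOn_of_memLp (Lp.memLp _))
      (integrableOn_of_memLp (Lp.memLp _))
      ((synthesis_hat f.toPW1).trans (synthesis_hat f).symm)
  rw [inner_def, L2.inner_def, measurement, ← integral_bandMeasure_pi]
  refine integral_congr_ae ?_
  filter_upwards [h] with x hx
  rw [hx]
  rfl

end PW

/-- A stable linear system `H : PW^1_π → PW^1_π` (a bounded linear operator) is time-invariant if
it commutes with all translations. -/
def IsTimeInvariant (H : PW 1 Real.pi →L[ℂ] PW 1 Real.pi) : Prop :=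
  ∀ (a : ℝ) (f : PW 1 Real.pi), H (PW.translate a f) = PW.translate a (H f)

end PaleyWiener

/-!
Evaluation on the real line is bounded by the norm of `PW^1_π`, and `H` is bounded, so everything
reduces to the convergence in `PW^1_π` of the expansions `∑ γ_n(f) s_n`. On the side of the
spectrum, the task is to find a uniformly bounded orthonormal basis `φ_n` of `L²([-π, π])` whose
Lebesgue functions `∫ |∑ n < N, φ_n(x) φ_n(y)| dy` are bounded, uniformly in `N`, for `x` in `[-π,
βπ)`. Then the partial sums are bounded in `L¹` on spectra supported there
(`integral_norm_sum_le`), and converge on the dense subspace `PW^2_π`, hence converge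
(`tendsto_partialSum`).

Split the band into `G = [-π, βπ)` and `B = [βπ, π)`. On `G` the Haar system has bounded Lebesgue
functions, its kernel being an averaging kernel, but it is unbounded. On `B` the Walsh system is
bounded, and the `L¹` norms of the sums of its consecutive members grow only logarithmically. The
two are mixed in blocks, following Olevskii (`exists_block`). In the block of the Haar function
`h`, of size `O(√M)`, take `M` Walsh functions `e_i` and put `g = (∑ e_i) / √M`. The functions
`e_i + (h - g) / √M` are bounded and orthonormal, and span the orthogonal complement of `g` in the
span of `h` and the `e_i`. The remaining vector `g` lives on `B`; it is made bounded by mixing it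
with `M - 1` further Walsh functions through repeated `(g ± r) / √2` (`exists_mix`), which has no
effect on the kernel at points of `G`. For `x` in `G` a partial sum of the kernel within the block
differs from a multiple of `h(x) h(y)` by `h(x) M^{-1/2}` times partial sums of the `e_i`, and the
`L¹` norm of this difference is `O(|h(x)| M^{-1/2} log M)` if the Walsh functions are used in
order. As the `k`-th Haar function is of size `O(k)`, the choice `M = 16 ^ k` makes this bounded
(`exists_bounded_system`).
-/

set_option linter.unusedSectionVars false

namespace BoundedBasis

section System

/-! ### Bounded measurable functions -/

/-- The algebra of bounded measurable real functions. All the functions of the construction live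
here, so that every integral below converges. -/
def boundedMeasurable (X : Type*) [MeasurableSpace X] : Subalgebra ℝ (X → ℝ) where
  carrier := {f | Measurable f ∧ ∃ C, ∀ x, |f x| ≤ C}
  mul_mem' := by
    rintro f g ⟨hf, C, hC⟩ ⟨hg, D, hD⟩
    refine ⟨hf.mul hg, C * D, fun x => ?_⟩
    rw [Pi.mul_apply, abs_mul]
    exact mul_le_mul (hC x) (hD x) (abs_nonneg _) ((abs_nonneg _).trans (hC x))
  add_mem' := by
    rintro f g ⟨hf, C, hC⟩ ⟨hg, D, hD⟩
    exact ⟨hf.add hg, C + D, fun x => (abs_add_le _ _).trans (add_le_add (hC x) (hD x))⟩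
  algebraMap_mem' r := ⟨measurable_const, |r|, fun _ => le_rfl⟩

variable {X : Type*} [MeasurableSpace X]

namespace boundedMeasurable

instance : CoeFun (boundedMeasurable X) (fun _ => X → ℝ) := ⟨fun f => f.1⟩

@[simp] theorem val_add (f g : boundedMeasurable X) (x : X) : (f + g) x = f x + g x := rfl
@[simp] theorem val_sub (f g : boundedMeasurable X) (x : X) : (f - g) x = f x - g x := rfl
@[simp] theorem val_mul (f g : boundedMeasurable X) (x : X) : (f * g) x = f x * g x := rfl
@[simp] theorem val_smul (c : ℝ) (f : boundedMeasurable X) (x : X) :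
    (c • f) x = c * f x := rfl

@[simp] theorem val_sum {ι : Type*} (s : Finset ι) (f : ι → boundedMeasurable X) (x : X) :
    (∑ i ∈ s, f i) x = ∑ i ∈ s, f i x := by
  have := AddSubmonoidClass.coe_finsetSum f s
  calc _ = ((∑ i ∈ s, f i : boundedMeasurable X) : X → ℝ) x := rfl
    _ = _ := by rw [this, Finset.sum_apply]

@[ext] theorem ext {f g : boundedMeasurable X} (h : ∀ x, f x = g x) : f = g :=
  Subtype.ext (funext h)

theorem measurable_coe (f : boundedMeasurable X) : Measurable f := f.2.1

theorem integrable_coe (f : boundedMeasurable X) (μ : Measure X) [IsFiniteMeasure μ] :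
    Integrable f μ := by
  obtain ⟨hf, C, hC⟩ := f.2
  exact Integrable.of_bound hf.aestronglyMeasurable C (Eventually.of_forall hC)

/-- The indicator function of a measurable set. -/
noncomputable def ind (s : Set X) (hs : MeasurableSet s) : boundedMeasurable X :=
  ⟨s.indicator 1, measurable_one.indicator hs, 1, fun x => by
    by_cases h : x ∈ s <;> simp [h]⟩

end boundedMeasurable

open boundedMeasurable

variable (μ : Measure X) [IsFiniteMeasure μ]

/-- The integral as a linear functional; `intg μ (f * g)` is the inner product of `f` and `g`. -/
noncomputable def intg : boundedMeasurable X →ₗ[ℝ] ℝ where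
  toFun f := ∫ x, f x ∂μ
  map_add' f g := integral_add (integrable_coe f μ) (integrable_coe g μ)
  map_smul' c _ := integral_const_mul c _

/-- The `L¹` seminorm on bounded measurable functions. -/
noncomputable def l1 (f : boundedMeasurable X) : ℝ := ∫ x, |f x| ∂μ

theorem intg_ind (s : Set X) (hs : MeasurableSet s) : intg μ (ind s hs) = μ.real s :=
  integral_indicator_one hs

theorem l1_nonneg (f : boundedMeasurable X) : 0 ≤ l1 μ f := integral_nonneg fun _ => abs_nonneg _

theorem l1_add_le (f g : boundedMeasurable X) : l1 μ (f + g) ≤ l1 μ f + l1 μ g := by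
  unfold l1
  rw [← integral_add (integrable_coe f μ).abs (integrable_coe g μ).abs]
  exact integral_mono (integrable_coe (f + g) μ).abs
    ((integrable_coe f μ).abs.add (integrable_coe g μ).abs) fun x => abs_add_le _ _

theorem l1_smul (c : ℝ) (f : boundedMeasurable X) : l1 μ (c • f) = |c| * l1 μ f := by
  unfold l1
  rw [← integral_const_mul]
  simp [abs_mul]

theorem l1_sub_le (f g : boundedMeasurable X) : l1 μ (f - g) ≤ l1 μ f + l1 μ g := by
  have := l1_add_le μ f ((-1 : ℝ) • g)
  rw [l1_smul] at this
  simpa [sub_eq_add_neg] using this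

theorem l1_eq_intg_of_nonneg {f : boundedMeasurable X} (h : ∀ x, 0 ≤ f x) :
    l1 μ f = intg μ f :=
  integral_congr_ae (Eventually.of_forall fun x => abs_of_nonneg (h x))

theorem l1_mono {f g : boundedMeasurable X} (h : ∀ x, |f x| ≤ |g x|) : l1 μ f ≤ l1 μ g :=
  integral_mono (integrable_coe f μ).abs (integrable_coe g μ).abs h

/-! ### Dyadic trees -/

/-- A dyadic tree of measurable sets in heap order: the root is `I 1`, of measure `v`, and each
node `I m` with `1 ≤ m` is split into two halves `I (2 * m)` and `I (2 * m + 1)` of equal measure.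
The value `I 0` plays no role. -/
structure IsDyadicTree (I : ℕ → Set X) (v : ℝ) : Prop where
  pos : 0 < v
  measurableSet : ∀ m, MeasurableSet (I m)
  union : ∀ m, 1 ≤ m → I (2 * m) ∪ I (2 * m + 1) = I m
  disjoint : ∀ m, 1 ≤ m → Disjoint (I (2 * m)) (I (2 * m + 1))
  measure : ∀ m, 1 ≤ m → μ.real (I m) = v / 2 ^ Nat.log 2 m

namespace IsDyadicTree

variable {μ} {I : ℕ → Set X} {v : ℝ}

theorem left_subset (T : IsDyadicTree μ I v) {m : ℕ} (hm : 1 ≤ m) : I (2 * m) ⊆ I m :=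
  (T.union m hm) ▸ Set.subset_union_left

theorem right_subset (T : IsDyadicTree μ I v) {m : ℕ} (hm : 1 ≤ m) : I (2 * m + 1) ⊆ I m :=
  (T.union m hm) ▸ Set.subset_union_right

/-- The nodes `m, …, 2m - 1` are the leaves of the tree after `m - 1` splittings; they are
pairwise disjoint. -/
theorem leaves_disjoint (T : IsDyadicTree μ I v) {m : ℕ} (hm : 1 ≤ m) :
    ∀ i ∈ Finset.Ico m (2 * m), ∀ j ∈ Finset.Ico m (2 * m), i ≠ j → Disjoint (I i) (I j) := by
  induction m, hm using Nat.le_induction with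
  | base =>
    intro i hi j hj hij
    simp only [Finset.mem_Ico] at hi hj
    omega
  | succ m hm ih =>
    -- every new leaf `i` is an old one other than `m`, or a half of `I m`
    have key : ∀ i ∈ Finset.Ico (m + 1) (2 * (m + 1)), i < 2 * m ∨ i = 2 * m ∨ i = 2 * m + 1 := by
      intro i hi
      simp only [Finset.mem_Ico] at hi
      omega
    have old : ∀ i ∈ Finset.Ico (m + 1) (2 * (m + 1)), i < 2 * m → Disjoint (I i) (I m) := by
      intro i hi h
      simp only [Finset.mem_Ico] at hi
      exact ih i (by simp; omega) m (by simp; omega) (by omega)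
    intro i hi j hj hij
    rcases key i hi with h | h | h <;> rcases key j hj with h' | h' | h'
    · simp only [Finset.mem_Ico] at hi hj
      exact ih i (by simp; omega) j (by simp; omega) hij
    · exact (old i hi h).mono_right (h' ▸ T.left_subset hm)
    · exact (old i hi h).mono_right (h' ▸ T.right_subset hm)
    · exact ((old j hj h').mono_right (h ▸ T.left_subset hm)).symm
    · omega
    · rw [h, h']; exact T.disjoint m hm
    · exact ((old j hj h').mono_right (h ▸ T.right_subset hm)).symm
    · rw [h, h']; exact (T.disjoint m hm).symm
    · omega

/-- The indicator function of the node `I m`. -/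
noncomputable def node (T : IsDyadicTree μ I v) (m : ℕ) : boundedMeasurable X :=
  ind (I m) (T.measurableSet m)

theorem node_apply (T : IsDyadicTree μ I v) (m : ℕ) (x : X) :
    T.node m x = (I m).indicator 1 x := rfl

theorem node_nonneg (T : IsDyadicTree μ I v) (m : ℕ) (x : X) : 0 ≤ T.node m x :=
  Set.indicator_nonneg (by simp) x

theorem node_split (T : IsDyadicTree μ I v) {m : ℕ} (hm : 1 ≤ m) :
    T.node m = T.node (2 * m) + T.node (2 * m + 1) := by
  ext x
  rw [val_add, node_apply, node_apply, node_apply, ← T.union m hm,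
    Set.indicator_union_of_disjoint (T.disjoint m hm)]

theorem node_mul_self (T : IsDyadicTree μ I v) (m : ℕ) : T.node m * T.node m = T.node m := by
  ext x
  by_cases h : x ∈ I m <;> simp [node_apply, h]

theorem node_mul_of_disjoint (T : IsDyadicTree μ I v) {i j : ℕ} (h : Disjoint (I i) (I j)) :
    T.node i * T.node j = 0 := by
  ext x
  by_cases hi : x ∈ I i
  · simp [node_apply, Set.disjoint_left.1 h hi]
  · simp [node_apply, hi]

theorem left_mul_node (T : IsDyadicTree μ I v) {m : ℕ} (hm : 1 ≤ m) :
    T.node (2 * m) * T.node m = T.node (2 * m) := by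
  rw [T.node_split hm, mul_add, node_mul_self, node_mul_of_disjoint T (T.disjoint m hm), add_zero]

theorem right_mul_node (T : IsDyadicTree μ I v) {m : ℕ} (hm : 1 ≤ m) :
    T.node (2 * m + 1) * T.node m = T.node (2 * m + 1) := by
  rw [T.node_split hm, mul_add, node_mul_self,
    node_mul_of_disjoint T (T.disjoint m hm).symm, zero_add]

theorem intg_node (T : IsDyadicTree μ I v) {m : ℕ} (hm : 1 ≤ m) :
    intg μ (T.node m) = v / 2 ^ Nat.log 2 m :=
  (intg_ind μ _ _).trans (T.measure m hm)

theorem log_two_mul {m : ℕ} (hm : 1 ≤ m) : Nat.log 2 (2 * m) = Nat.log 2 m + 1 := by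
  rw [mul_comm, Nat.log_mul_base (by norm_num) (by omega)]

theorem log_two_mul_add_one {m : ℕ} (hm : 1 ≤ m) :
    Nat.log 2 (2 * m + 1) = Nat.log 2 m + 1 := by
  rw [Nat.log_of_one_lt_of_le (by norm_num) (by omega)]
  congr 2
  omega

theorem intg_left (T : IsDyadicTree μ I v) {m : ℕ} (hm : 1 ≤ m) :
    intg μ (T.node (2 * m)) = v / 2 ^ Nat.log 2 m / 2 := by
  rw [T.intg_node (by omega), log_two_mul hm, pow_succ, div_div]

theorem intg_right (T : IsDyadicTree μ I v) {m : ℕ} (hm : 1 ≤ m) :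
    intg μ (T.node (2 * m + 1)) = v / 2 ^ Nat.log 2 m / 2 := by
  rw [T.intg_node (by omega), log_two_mul_add_one hm, pow_succ, div_div]

/-- The difference of the indicators of the two halves of a node. -/
noncomputable def jump (T : IsDyadicTree μ I v) (m : ℕ) : boundedMeasurable X :=
  T.node (2 * m) - T.node (2 * m + 1)

theorem intg_jump (T : IsDyadicTree μ I v) {m : ℕ} (hm : 1 ≤ m) : intg μ (T.jump m) = 0 := by
  rw [jump, map_sub, T.intg_left hm, T.intg_right hm, sub_self]

theorem jump_mul_node (T : IsDyadicTree μ I v) {m : ℕ} (hm : 1 ≤ m) :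
    T.jump m * T.node m = T.jump m := by
  rw [jump, sub_mul, T.left_mul_node hm, T.right_mul_node hm]

theorem jump_mul_left (T : IsDyadicTree μ I v) {m : ℕ} (hm : 1 ≤ m) :
    T.jump m * T.node (2 * m) = T.node (2 * m) := by
  rw [jump, sub_mul, node_mul_self, node_mul_of_disjoint T (T.disjoint m hm).symm, sub_zero]

theorem jump_mul_right (T : IsDyadicTree μ I v) {m : ℕ} (hm : 1 ≤ m) :
    T.jump m * T.node (2 * m + 1) = -T.node (2 * m + 1) := by
  rw [jump, sub_mul, node_mul_self, node_mul_of_disjoint T (T.disjoint m hm), zero_sub]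

theorem jump_mul_self (T : IsDyadicTree μ I v) {m : ℕ} (hm : 1 ≤ m) :
    T.jump m * T.jump m = T.node m := by
  conv_lhs => rhs; rw [jump]
  rw [mul_sub, T.jump_mul_left hm, T.jump_mul_right hm, sub_neg_eq_add, ← T.node_split hm]

/-- Functions that are constant on each of the leaves `m, …, 2m - 1`. -/
noncomputable def leafSpan (T : IsDyadicTree μ I v) (m : ℕ) : Submodule ℝ (boundedMeasurable X) :=
  Submodule.span ℝ (T.node '' Finset.Ico m (2 * m))

theorem node_mem_leafSpan (T : IsDyadicTree μ I v) {m i : ℕ} (h : m ≤ i) (h' : i < 2 * m) :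
    T.node i ∈ T.leafSpan m :=
  Submodule.subset_span ⟨i, by simp [h, h'], rfl⟩

theorem leafSpan_le_succ (T : IsDyadicTree μ I v) {m : ℕ} (hm : 1 ≤ m) :
    T.leafSpan m ≤ T.leafSpan (m + 1) := by
  refine Submodule.span_le.2 ?_
  rintro _ ⟨i, hi, rfl⟩
  simp only [Finset.coe_Ico, Set.mem_Ico] at hi
  rcases eq_or_lt_of_le hi.1 with h | h
  · subst h
    rw [T.node_split hm]
    exact add_mem (T.node_mem_leafSpan (by omega) (by omega))
      (T.node_mem_leafSpan (by omega) (by omega))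
  · exact T.node_mem_leafSpan (by omega) (by omega)

theorem leafSpan_mono (T : IsDyadicTree μ I v) {m n : ℕ} (hm : 1 ≤ m) (hn : m ≤ n) :
    T.leafSpan m ≤ T.leafSpan n := by
  induction n, hn using Nat.le_induction with
  | base => exact le_rfl
  | succ n hn ih => exact ih.trans (T.leafSpan_le_succ (hm.trans hn))

theorem jump_mem_leafSpan (T : IsDyadicTree μ I v) {m : ℕ} (hm : 1 ≤ m) :
    T.jump m ∈ T.leafSpan (m + 1) :=
  sub_mem (T.node_mem_leafSpan (by omega) (by omega))
    (T.node_mem_leafSpan (by omega) (by omega))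

theorem node_mul_mem_leafSpan (T : IsDyadicTree μ I v) {m i : ℕ} (hm : 1 ≤ m) (h : m ≤ i)
    (h' : i < 2 * m) {f : boundedMeasurable X} (hf : f ∈ T.leafSpan m) :
    ∃ c : ℝ, f * T.node i = c • T.node i := by
  induction hf using Submodule.span_induction with
  | mem f hf =>
    obtain ⟨j, hj, rfl⟩ := hf
    rcases eq_or_ne j i with rfl | hij
    · exact ⟨1, by rw [node_mul_self, one_smul]⟩
    · refine ⟨0, ?_⟩
      rw [T.node_mul_of_disjoint (T.leaves_disjoint hm j hj i (by simp [h, h']) hij), zero_smul]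
  | zero => exact ⟨0, by simp⟩
  | add f g _ _ hf hg =>
    obtain ⟨c, hc⟩ := hf
    obtain ⟨d, hd⟩ := hg
    exact ⟨c + d, by rw [add_mul, hc, hd, add_smul]⟩
  | smul a f _ hf =>
    obtain ⟨c, hc⟩ := hf
    exact ⟨a * c, by rw [smul_mul_assoc, hc, smul_smul]⟩

theorem mul_mem_leafSpan (T : IsDyadicTree μ I v) {m : ℕ} (hm : 1 ≤ m)
    {f g : boundedMeasurable X} (hf : f ∈ T.leafSpan m) (hg : g ∈ T.leafSpan m) :
    f * g ∈ T.leafSpan m := by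
  induction hg using Submodule.span_induction with
  | mem g hg =>
    obtain ⟨i, hi, rfl⟩ := hg
    simp only [Finset.coe_Ico, Set.mem_Ico] at hi
    obtain ⟨c, hc⟩ := T.node_mul_mem_leafSpan hm hi.1 hi.2 hf
    rw [hc]
    exact Submodule.smul_mem _ _ (T.node_mem_leafSpan hi.1 hi.2)
  | zero => simp
  | add g g' _ _ h h' => rw [mul_add]; exact add_mem h h'
  | smul a g _ h => rw [mul_smul_comm]; exact Submodule.smul_mem _ _ h

theorem sum_leaves (T : IsDyadicTree μ I v) {m : ℕ} (hm : 1 ≤ m) :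
    ∑ i ∈ Finset.Ico m (2 * m), T.node i = T.node 1 := by
  induction m, hm using Nat.le_induction with
  | base => simp
  | succ m hm ih =>
    rw [← ih, Finset.sum_eq_sum_Ico_succ_bot (by omega : m < 2 * m), T.node_split hm,
      show 2 * (m + 1) = 2 * m + 1 + 1 by ring, Finset.sum_Ico_succ_top (by omega),
      Finset.sum_Ico_succ_top (by omega)]
    ring

theorem node_one_mul (T : IsDyadicTree μ I v) {m : ℕ} (hm : 1 ≤ m) {f : boundedMeasurable X}
    (hf : f ∈ T.leafSpan m) : T.node 1 * f = f := by
  induction hf using Submodule.span_induction with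
  | mem g hg =>
    obtain ⟨i, hi, rfl⟩ := hg
    rw [← T.sum_leaves hm, Finset.sum_mul, Finset.sum_eq_single_of_mem i hi, node_mul_self]
    intro j hj hij
    exact T.node_mul_of_disjoint (T.leaves_disjoint hm j hj i hi hij)
  | zero => simp
  | add g g' _ _ h h' => rw [mul_add, h, h']
  | smul a g _ h => rw [mul_smul_comm, h]

theorem jump_mul_mem_leafSpan (T : IsDyadicTree μ I v) {m i : ℕ} (hm : 1 ≤ m) (h : m ≤ i)
    (h' : i < 2 * m) {f : boundedMeasurable X} (hf : f ∈ T.leafSpan m) :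
    ∃ c : ℝ, T.jump i * f = c • T.jump i := by
  obtain ⟨c, hc⟩ := T.node_mul_mem_leafSpan hm h h' hf
  refine ⟨c, ?_⟩
  rw [← T.jump_mul_node (hm.trans h), mul_assoc, mul_comm _ f, hc, mul_smul_comm]

/-- The jump of a leaf is orthogonal to all functions that are constant on the leaves. -/
theorem intg_jump_mul (T : IsDyadicTree μ I v) {m i : ℕ} (hm : 1 ≤ m) (h : m ≤ i)
    (h' : i < 2 * m) {f : boundedMeasurable X} (hf : f ∈ T.leafSpan m) :
    intg μ (T.jump i * f) = 0 := by
  obtain ⟨c, hc⟩ := T.jump_mul_mem_leafSpan hm h h' hf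
  rw [hc, map_smul, T.intg_jump (hm.trans h), smul_zero]

/-! ### The Haar system -/

/-- The Haar function of index `m`, normalised in `L²`: the root indicator for `m = 0`, and the
function that splits the node `m` for `m ≥ 1`. -/
noncomputable def haar (T : IsDyadicTree μ I v) (m : ℕ) : boundedMeasurable X :=
  (√(v / 2 ^ Nat.log 2 m))⁻¹ • if m = 0 then T.node 1 else T.jump m

theorem node_measure_pos (T : IsDyadicTree μ I v) (m : ℕ) : 0 < v / 2 ^ Nat.log 2 m := by
  have := T.pos
  positivity

theorem haar_zero (T : IsDyadicTree μ I v) : T.haar 0 = (√v)⁻¹ • T.node 1 := by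
  simp [haar]

theorem haar_of_pos (T : IsDyadicTree μ I v) {m : ℕ} (hm : 1 ≤ m) :
    T.haar m = (√(v / 2 ^ Nat.log 2 m))⁻¹ • T.jump m := by
  rw [haar, if_neg (by omega)]

theorem haar_mem_leafSpan (T : IsDyadicTree μ I v) (m : ℕ) : T.haar m ∈ T.leafSpan (m + 1) := by
  rcases Nat.eq_zero_or_pos m with rfl | hm
  · rw [haar_zero]
    exact Submodule.smul_mem _ _ (T.node_mem_leafSpan (by omega) (by omega))
  · rw [T.haar_of_pos hm]
    exact Submodule.smul_mem _ _ (T.jump_mem_leafSpan hm)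

theorem haar_orthonormal (T : IsDyadicTree μ I v) (i j : ℕ) :
    intg μ (T.haar i * T.haar j) = if i = j then 1 else 0 := by
  have off : ∀ i j, i < j → intg μ (T.haar j * T.haar i) = 0 := by
    intro i j hij
    rw [T.haar_of_pos (by omega : 1 ≤ j), smul_mul_assoc, map_smul,
      T.intg_jump_mul (m := j) (by omega) le_rfl (by omega), smul_zero]
    exact T.leafSpan_mono (by omega) hij (T.haar_mem_leafSpan i)
  rcases lt_trichotomy i j with h | rfl | h
  · rw [mul_comm, off i j h, if_neg h.ne]
  · rw [if_pos rfl]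
    have hp := T.node_measure_pos i
    rcases Nat.eq_zero_or_pos i with rfl | hi
    · rw [haar_zero, smul_mul_smul_comm, node_mul_self, map_smul, T.intg_node le_rfl]
      simp only [Nat.log_zero_right, pow_zero, div_one] at hp
      simp only [Nat.log_one_right, pow_zero, div_one, smul_eq_mul]
      rw [← mul_inv, Real.mul_self_sqrt hp.le, inv_mul_cancel₀ hp.ne']
    · rw [T.haar_of_pos hi, smul_mul_smul_comm, T.jump_mul_self hi, map_smul, T.intg_node hi,
        smul_eq_mul, ← mul_inv, Real.mul_self_sqrt hp.le, inv_mul_cancel₀ hp.ne']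
  · rw [off j i h, if_neg h.ne']

/-- All nodes are in the span of the Haar system. -/
theorem node_mem_span_haar (T : IsDyadicTree μ I v) (m : ℕ) (hm : 1 ≤ m) :
    T.node m ∈ Submodule.span ℝ (Set.range T.haar) := by
  have hj : ∀ m, 1 ≤ m → T.jump m ∈ Submodule.span ℝ (Set.range T.haar) := by
    intro m hm
    have : T.jump m = √(v / 2 ^ Nat.log 2 m) • T.haar m := by
      rw [T.haar_of_pos hm, smul_inv_smul₀ (Real.sqrt_pos.2 (T.node_measure_pos m)).ne']
    rw [this]
    exact Submodule.smul_mem _ _ (Submodule.subset_span ⟨m, rfl⟩)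
  induction m using Nat.strong_induction_on with
  | _ m ih =>
    rcases eq_or_lt_of_le hm with rfl | h1
    · have : T.node 1 = √v • T.haar 0 := by
        rw [haar_zero, smul_inv_smul₀ (Real.sqrt_pos.2 T.pos).ne']
      rw [this]
      exact Submodule.smul_mem _ _ (Submodule.subset_span ⟨0, rfl⟩)
    · have hk := ih (m / 2) (by omega) (by omega)
      have hjk := hj (m / 2) (by omega)
      have hs := T.node_split (m := m / 2) (by omega)
      rcases Nat.even_or_odd' m with ⟨k, rfl | rfl⟩
      · have e : 2 * k / 2 = k := by omega
        rw [e] at hk hjk hs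
        have : T.node (2 * k) = (2⁻¹ : ℝ) • (T.node k + T.jump k) := by
          rw [hs, jump]; ext x; simp; ring
        rw [this]
        exact Submodule.smul_mem _ _ (add_mem hk hjk)
      · have e : (2 * k + 1) / 2 = k := by omega
        rw [e] at hk hjk hs
        have : T.node (2 * k + 1) = (2⁻¹ : ℝ) • (T.node k - T.jump k) := by
          rw [hs, jump]; ext x; simp; ring
        rw [this]
        exact Submodule.smul_mem _ _ (sub_mem hk hjk)

/-- The kernel of the orthogonal projection onto the first `m` Haar functions is that of the
averaging over leaves. -/
theorem sum_haar_mul_haar (T : IsDyadicTree μ I v) {m : ℕ} (hm : 1 ≤ m) (x y : X) :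
    ∑ i ∈ Finset.range m, T.haar i x * T.haar i y =
      ∑ j ∈ Finset.Ico m (2 * m), (v / 2 ^ Nat.log 2 j)⁻¹ * (T.node j x * T.node j y) := by
  induction m, hm using Nat.le_induction with
  | base =>
    have hv := T.pos
    simp only [Finset.range_one, Finset.sum_singleton, haar_zero, val_smul,
      show Finset.Ico 1 (2 * 1) = {1} from rfl, Nat.log_one_right, pow_zero, div_one]
    rw [mul_mul_mul_comm, ← mul_inv, Real.mul_self_sqrt hv.le]
  | succ m hm ih =>
    have hp := T.node_measure_pos m
    rw [Finset.sum_range_succ, ih, Finset.sum_eq_sum_Ico_succ_bot (by omega : m < 2 * m),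
      T.node_split hm, T.haar_of_pos hm,
      show 2 * (m + 1) = 2 * m + 1 + 1 by ring, Finset.sum_Ico_succ_top (by omega),
      Finset.sum_Ico_succ_top (by omega), log_two_mul hm, log_two_mul_add_one hm, val_smul,
      val_smul, mul_mul_mul_comm, ← mul_inv, Real.mul_self_sqrt hp.le, jump]
    simp only [val_add, val_sub, pow_succ, ← div_div, inv_div]
    field_simp
    ring

theorem l1_sum_haar_le (T : IsDyadicTree μ I v) (m : ℕ) (x : X) :
    l1 μ (∑ i ∈ Finset.range m, T.haar i x • T.haar i) ≤ 1 := by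
  rcases Nat.eq_zero_or_pos m with rfl | hm
  · simp [l1]
  have e : ∑ i ∈ Finset.range m, T.haar i x • T.haar i =
      ∑ j ∈ Finset.Ico m (2 * m), ((v / 2 ^ Nat.log 2 j)⁻¹ * T.node j x) • T.node j := by
    ext y
    simp only [val_sum, val_smul, T.sum_haar_mul_haar hm, mul_assoc]
  rw [e, l1_eq_intg_of_nonneg]
  · rw [map_sum]
    have : ∀ j ∈ Finset.Ico m (2 * m),
        intg μ (((v / 2 ^ Nat.log 2 j)⁻¹ * T.node j x) • T.node j) = T.node j x := by
      intro j hj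
      simp only [Finset.mem_Ico] at hj
      rw [map_smul, T.intg_node (by omega), smul_eq_mul, mul_right_comm,
        inv_mul_cancel₀ (T.node_measure_pos j).ne', one_mul]
    rw [Finset.sum_congr rfl this, ← val_sum, T.sum_leaves hm, node_apply]
    exact Set.indicator_le_self' (by simp) x
  · intro y
    simp only [val_sum, val_smul]
    exact Finset.sum_nonneg fun j _ => mul_nonneg
      (mul_nonneg (inv_nonneg.2 (T.node_measure_pos j).le) (T.node_nonneg _ _)) (T.node_nonneg _ _)

theorem abs_jump (T : IsDyadicTree μ I v) {m : ℕ} (hm : 1 ≤ m) (x : X) :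
    |T.jump m x| = T.node m x := by
  have h := congrArg (fun f : boundedMeasurable X => f x) (T.jump_mul_self hm)
  have h2 := congrArg (fun f : boundedMeasurable X => f x) (T.node_mul_self m)
  simp only [val_mul] at h h2
  rw [← abs_of_nonneg (T.node_nonneg m x)]
  exact (mul_self_eq_mul_self_iff.1 (h.trans h2.symm)).elim (fun h => by rw [h])
    fun h => by rw [h, abs_neg]

theorem abs_haar_eq (T : IsDyadicTree μ I v) (m : ℕ) (x : X) :
    |T.haar m x| = (√(v / 2 ^ Nat.log 2 m))⁻¹ * T.node (max m 1) x := by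
  rw [← abs_of_pos (inv_pos.2 (Real.sqrt_pos.2 (T.node_measure_pos m)))]
  rcases Nat.eq_zero_or_pos m with rfl | hm
  · simp [haar_zero, abs_mul, abs_of_nonneg (T.node_nonneg 1 x)]
  · rw [T.haar_of_pos hm, val_smul, abs_mul, T.abs_jump hm, max_eq_left hm]

/-- The terms of the Haar kernel are bounded in `L¹`, so that adding a fraction of the next one does
no harm. -/
theorem abs_haar_mul_l1_le (T : IsDyadicTree μ I v) (m : ℕ) (x : X) :
    |T.haar m x| * l1 μ (T.haar m) ≤ 1 := by
  have hp := T.node_measure_pos m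
  have h1 : l1 μ (T.haar m) = (√(v / 2 ^ Nat.log 2 m))⁻¹ * (v / 2 ^ Nat.log 2 m) := by
    unfold l1
    simp_rw [abs_haar_eq]
    rw [integral_const_mul]
    congr 1
    have := T.intg_node (m := max m 1) (le_max_right _ _)
    have e : Nat.log 2 (max m 1) = Nat.log 2 m := by
      rcases Nat.eq_zero_or_pos m with rfl | hm
      · simp
      · rw [max_eq_left hm]
    rw [e] at this
    exact this
  have h2 : T.node (max m 1) x ≤ 1 := Set.indicator_le_self' (by simp) x
  rw [h1, abs_haar_eq]
  calc _ = (√(v / 2 ^ Nat.log 2 m) * √(v / 2 ^ Nat.log 2 m))⁻¹ * (v / 2 ^ Nat.log 2 m) *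
        T.node (max m 1) x := by rw [mul_inv]; ring
    _ ≤ 1 := by rwa [Real.mul_self_sqrt hp.le, inv_mul_cancel₀ hp.ne', one_mul]

theorem abs_haar_le (T : IsDyadicTree μ I v) (m : ℕ) (x : X) :
    |T.haar m x| ≤ (√v)⁻¹ * (m + 1) := by
  have hv := Real.sqrt_pos.2 T.pos
  have h2 : T.node (max m 1) x ≤ 1 := Set.indicator_le_self' (by simp) x
  rw [abs_haar_eq, Real.sqrt_div T.pos.le, inv_div, div_eq_inv_mul]
  refine (mul_le_of_le_one_right (by positivity) h2).trans ?_
  refine mul_le_mul_of_nonneg_left ?_ (by positivity)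
  rw [Real.sqrt_le_left (by positivity)]
  have h3 : (2 : ℝ) ^ Nat.log 2 m ≤ m + 1 := by
    rcases Nat.eq_zero_or_pos m with rfl | hm
    · simp
    · have : 2 ^ Nat.log 2 m ≤ m := Nat.pow_log_le_self 2 (by omega)
      exact_mod_cast this.trans (Nat.le_succ m)
  have : (1 : ℝ) ≤ m + 1 := by simp
  nlinarith

theorem haar_apply_of_notMem (T : IsDyadicTree μ I v) (m : ℕ) {x : X} (hx : x ∉ I 1) :
    T.haar m x = 0 := by
  have h := congrArg (fun f : boundedMeasurable X => f x)
    (T.node_one_mul (by omega) (T.haar_mem_leafSpan m))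
  simpa [node_apply, hx] using h.symm

/-! ### The Walsh system -/

/-- The Rademacher function of level `K`: it is `1` on the left and `-1` on the right half of each
of the `2 ^ K` nodes of level `K`. -/
noncomputable def rad (T : IsDyadicTree μ I v) (K : ℕ) : boundedMeasurable X :=
  ∑ m ∈ Finset.Ico (2 ^ K) (2 * 2 ^ K), T.jump m

theorem rad_mul_node (T : IsDyadicTree μ I v) {K m : ℕ} (h : 2 ^ K ≤ m) (h' : m < 2 * 2 ^ K) :
    T.rad K * T.node m = T.jump m := by
  have hK : 1 ≤ 2 ^ K := Nat.one_le_two_pow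
  have hm : m ∈ Finset.Ico (2 ^ K) (2 * 2 ^ K) := by simp [h, h']
  rw [rad, Finset.sum_mul, Finset.sum_eq_single_of_mem m hm, T.jump_mul_node (hK.trans h)]
  intro j hj hjm
  have hj1 : 1 ≤ j := hK.trans (Finset.mem_Ico.1 hj).1
  rw [← T.jump_mul_node hj1, mul_assoc,
    T.node_mul_of_disjoint (T.leaves_disjoint hK j hj m hm hjm), mul_zero]

theorem rad_mul_self (T : IsDyadicTree μ I v) (K : ℕ) : T.rad K * T.rad K = T.node 1 := by
  have hK : 1 ≤ 2 ^ K := Nat.one_le_two_pow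
  conv_lhs => rhs; rw [rad]
  rw [Finset.mul_sum, ← T.sum_leaves hK]
  refine Finset.sum_congr rfl fun m hm => ?_
  simp only [Finset.mem_Ico] at hm
  rw [← T.jump_mul_node (hK.trans hm.1), mul_comm _ (T.node m), ← mul_assoc,
    T.rad_mul_node hm.1 hm.2, T.jump_mul_self (hK.trans hm.1)]

theorem intg_rad_mul (T : IsDyadicTree μ I v) (K : ℕ) {f : boundedMeasurable X}
    (hf : f ∈ T.leafSpan (2 ^ K)) : intg μ (T.rad K * f) = 0 := by
  rw [rad, Finset.sum_mul, map_sum]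
  refine Finset.sum_eq_zero fun m hm => ?_
  simp only [Finset.mem_Ico] at hm
  exact T.intg_jump_mul Nat.one_le_two_pow hm.1 hm.2 hf

theorem rad_mem_leafSpan (T : IsDyadicTree μ I v) (K : ℕ) :
    T.rad K ∈ T.leafSpan (2 ^ (K + 1)) := by
  refine sum_mem fun m hm => ?_
  simp only [Finset.mem_Ico] at hm
  have hK : 1 ≤ 2 ^ K := Nat.one_le_two_pow
  exact T.leafSpan_mono (by omega) (by rw [pow_succ]; omega)
    (T.jump_mem_leafSpan (hK.trans hm.1))

/-- The Walsh functions in Paley's order, with values `±1` on the root: `walsh (2 ^ K + j)` is the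
product of `rad K` and `walsh j` for `j < 2 ^ K`. -/
noncomputable def walsh (T : IsDyadicTree μ I v) (n : ℕ) : boundedMeasurable X :=
  if _h : n = 0 then T.node 1 else T.rad (Nat.log 2 n) * T.walsh (n - 2 ^ Nat.log 2 n)
termination_by n
decreasing_by
  have : 0 < 2 ^ Nat.log 2 n := by positivity
  omega

theorem walsh_zero (T : IsDyadicTree μ I v) : T.walsh 0 = T.node 1 := by
  rw [walsh, dif_pos rfl]

theorem walsh_add (T : IsDyadicTree μ I v) {K j : ℕ} (hj : j < 2 ^ K) :
    T.walsh (2 ^ K + j) = T.rad K * T.walsh j := by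
  have hK : 1 ≤ 2 ^ K := Nat.one_le_two_pow
  have e : Nat.log 2 (2 ^ K + j) = K :=
    (Nat.log_eq_iff (Or.inr ⟨by norm_num, by omega⟩)).2 ⟨by omega, by rw [pow_succ]; omega⟩
  rw [walsh, dif_neg (by omega), e, Nat.add_sub_cancel_left]

theorem exists_eq_two_pow_add {K n : ℕ} (h : 2 ^ K ≤ n) (h' : n < 2 ^ (K + 1)) :
    ∃ j < 2 ^ K, n = 2 ^ K + j :=
  ⟨n - 2 ^ K, by rw [pow_succ] at h'; omega, by omega⟩

theorem walsh_mem_leafSpan (T : IsDyadicTree μ I v) (K : ℕ) :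
    ∀ j < 2 ^ K, T.walsh j ∈ T.leafSpan (2 ^ K) := by
  induction K with
  | zero =>
    intro j hj
    rw [Nat.lt_one_iff.1 hj, walsh_zero]
    exact T.node_mem_leafSpan (by norm_num) (by norm_num)
  | succ K ih =>
    have hmono : T.leafSpan (2 ^ K) ≤ T.leafSpan (2 ^ (K + 1)) :=
      T.leafSpan_mono Nat.one_le_two_pow (Nat.pow_le_pow_right (by norm_num) (by omega))
    intro j hj
    rcases lt_or_ge j (2 ^ K) with h | h
    · exact hmono (ih j h)
    · obtain ⟨i, hi, rfl⟩ := exists_eq_two_pow_add h hj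
      rw [T.walsh_add hi]
      exact T.mul_mem_leafSpan Nat.one_le_two_pow (T.rad_mem_leafSpan K) (hmono (ih i hi))

theorem node_one_mul_walsh (T : IsDyadicTree μ I v) (n : ℕ) :
    T.node 1 * T.walsh n = T.walsh n :=
  T.node_one_mul Nat.one_le_two_pow (T.walsh_mem_leafSpan n n Nat.lt_two_pow_self)

theorem walsh_mul_self (T : IsDyadicTree μ I v) (n : ℕ) :
    T.walsh n * T.walsh n = T.node 1 := by
  induction n using Nat.strong_induction_on with
  | _ n ih =>
    rcases Nat.eq_zero_or_pos n with rfl | hn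
    · rw [walsh_zero, node_mul_self]
    · obtain ⟨j, hj, e⟩ := exists_eq_two_pow_add (Nat.pow_log_le_self 2 hn.ne')
        (Nat.lt_pow_succ_log_self (by norm_num) n)
      have : 1 ≤ 2 ^ Nat.log 2 n := Nat.one_le_two_pow
      rw [e, T.walsh_add hj, mul_mul_mul_comm, rad_mul_self, ih j (by omega), node_mul_self]

theorem abs_walsh_le (T : IsDyadicTree μ I v) (n : ℕ) (x : X) : |T.walsh n x| ≤ 1 := by
  have h := congrArg (fun f : boundedMeasurable X => f x) (T.walsh_mul_self n)
  have h2 : T.node 1 x ≤ 1 := Set.indicator_le_self' (by simp) x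
  simp only [val_mul] at h
  exact abs_le_one_iff_mul_self_le_one.2 (h.trans_le h2)

theorem walsh_apply_of_notMem (T : IsDyadicTree μ I v) (n : ℕ) {x : X} (hx : x ∉ I 1) :
    T.walsh n x = 0 := by
  have h := congrArg (fun f : boundedMeasurable X => f x) (T.node_one_mul_walsh n)
  simpa [node_apply, hx] using h.symm

theorem intg_walsh_mul_walsh_of_lt (T : IsDyadicTree μ I v) (K : ℕ) :
    ∀ j < 2 ^ K, ∀ i < j, intg μ (T.walsh j * T.walsh i) = 0 := by
  induction K with
  | zero => intro j hj i hi; simp at hj; omega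
  | succ K ih =>
    intro j hj i hi
    rcases lt_or_ge j (2 ^ K) with h | h
    · exact ih j h i hi
    · obtain ⟨j', hj', rfl⟩ := exists_eq_two_pow_add h hj
      rw [T.walsh_add hj']
      rcases lt_or_ge i (2 ^ K) with h' | h'
      · rw [mul_assoc]
        exact T.intg_rad_mul K (T.mul_mem_leafSpan Nat.one_le_two_pow
          (T.walsh_mem_leafSpan K _ hj') (T.walsh_mem_leafSpan K _ h'))
      · obtain ⟨i', hi', rfl⟩ := exists_eq_two_pow_add h' (hi.trans hj)
        rw [T.walsh_add hi', mul_mul_mul_comm, rad_mul_self, ← mul_assoc, node_one_mul_walsh]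
        exact ih j' hj' i' (by omega)

theorem intg_walsh_mul_walsh (T : IsDyadicTree μ I v) (i j : ℕ) :
    intg μ (T.walsh i * T.walsh j) = if i = j then v else 0 := by
  rcases lt_trichotomy i j with h | rfl | h
  · rw [mul_comm, T.intg_walsh_mul_walsh_of_lt j j Nat.lt_two_pow_self i h, if_neg h.ne]
  · rw [if_pos rfl, walsh_mul_self, T.intg_node le_rfl]; simp
  · rw [T.intg_walsh_mul_walsh_of_lt i i Nat.lt_two_pow_self j h, if_neg h.ne']

theorem intg_walsh (T : IsDyadicTree μ I v) (n : ℕ) :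
    intg μ (T.walsh n) = if n = 0 then v else 0 := by
  rw [← T.node_one_mul_walsh, ← walsh_zero, intg_walsh_mul_walsh]
  simp [eq_comm]

theorem sum_walsh_two_pow_add (T : IsDyadicTree μ I v) {K j : ℕ} (hj : j ≤ 2 ^ K) :
    ∑ i ∈ Finset.range (2 ^ K + j), T.walsh i =
      ∑ i ∈ Finset.range (2 ^ K), T.walsh i + T.rad K * ∑ i ∈ Finset.range j, T.walsh i := by
  rw [Finset.sum_range_add, Finset.mul_sum]
  congr 1
  exact Finset.sum_congr rfl fun i hi => T.walsh_add ((Finset.mem_range.1 hi).trans_le hj)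

theorem abs_rad_le (T : IsDyadicTree μ I v) (K : ℕ) (x : X) : |T.rad K x| ≤ 1 := by
  have h := congrArg (fun f : boundedMeasurable X => f x) (T.rad_mul_self K)
  have h2 : T.node 1 x ≤ 1 := Set.indicator_le_self' (by simp) x
  simp only [val_mul] at h
  exact abs_le_one_iff_mul_self_le_one.2 (h.trans_le h2)

theorem sum_walsh_two_pow_nonneg (T : IsDyadicTree μ I v) (K : ℕ) (x : X) :
    0 ≤ (∑ i ∈ Finset.range (2 ^ K), T.walsh i) x := by
  induction K with
  | zero => simpa [walsh_zero] using T.node_nonneg 1 x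
  | succ K ih =>
    rw [pow_succ, mul_two, T.sum_walsh_two_pow_add le_rfl, val_add, val_mul]
    have := (abs_le.1 (T.abs_rad_le K x)).1
    nlinarith

/-- The logarithmic bound for the Lebesgue constants of the Walsh system. -/
theorem l1_sum_walsh_le (T : IsDyadicTree μ I v) (K : ℕ) :
    ∀ n ≤ 2 ^ K, l1 μ (∑ i ∈ Finset.range n, T.walsh i) ≤ v * (K + 1) := by
  have two_pow : ∀ K, l1 μ (∑ i ∈ Finset.range (2 ^ K), T.walsh i) = v := by
    intro K
    rw [l1_eq_intg_of_nonneg μ (T.sum_walsh_two_pow_nonneg K), map_sum]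
    simp [intg_walsh]
  have hv := T.pos
  induction K with
  | zero =>
    intro n hn
    rcases Nat.le_one_iff_eq_zero_or_eq_one.1 hn with rfl | rfl
    · simpa [l1] using hv.le
    · simpa using (two_pow 0).le
  | succ K ih =>
    intro n hn
    push_cast
    rcases lt_or_ge n (2 ^ K) with h | h
    · have := ih n h.le
      nlinarith
    · obtain ⟨j, rfl⟩ := Nat.exists_eq_add_of_le h
      have hj : j ≤ 2 ^ K := by rw [pow_succ] at hn; omega
      rw [T.sum_walsh_two_pow_add hj]
      refine (l1_add_le μ _ _).trans ?_
      rw [two_pow]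
      have h1 : l1 μ (T.rad K * ∑ i ∈ Finset.range j, T.walsh i) ≤
          l1 μ (∑ i ∈ Finset.range j, T.walsh i) := l1_mono μ fun x => by
        rw [val_mul, abs_mul]
        exact mul_le_of_le_one_left (abs_nonneg _) (T.abs_rad_le K x)
      have := ih j hj
      nlinarith

theorem rad_mul_mem_span_walsh (T : IsDyadicTree μ I v) (K : ℕ) {f : boundedMeasurable X}
    (hf : f ∈ Submodule.span ℝ (T.walsh '' Set.Iio (2 ^ K))) :
    T.rad K * f ∈ Submodule.span ℝ (T.walsh '' Set.Iio (2 ^ (K + 1))) := by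
  induction hf using Submodule.span_induction with
  | mem g hg =>
    obtain ⟨i, hi, rfl⟩ := hg
    rw [Set.mem_Iio] at hi
    rw [← T.walsh_add hi]
    exact Submodule.subset_span ⟨_, by rw [Set.mem_Iio, pow_succ]; omega, rfl⟩
  | zero => simp
  | add g g' _ _ h h' => rw [mul_add]; exact add_mem h h'
  | smul a g _ h => rw [mul_smul_comm]; exact Submodule.smul_mem _ _ h

theorem node_mem_span_walsh_lt (T : IsDyadicTree μ I v) (K : ℕ) :
    ∀ m, 2 ^ K ≤ m → m < 2 * 2 ^ K →
      T.node m ∈ Submodule.span ℝ (T.walsh '' Set.Iio (2 ^ K)) := by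
  induction K with
  | zero =>
    intro m h h'
    obtain rfl : m = 1 := by omega
    exact Submodule.subset_span ⟨0, by simp, T.walsh_zero⟩
  | succ K ih =>
    intro m h h'
    rw [pow_succ] at h h'
    have hK : 1 ≤ 2 ^ K := Nat.one_le_two_pow
    have hk := ih (m / 2) (by omega) (by omega)
    have hj := T.rad_mul_mem_span_walsh K hk
    rw [T.rad_mul_node (by omega) (by omega)] at hj
    have hk' : T.node (m / 2) ∈ Submodule.span ℝ (T.walsh '' Set.Iio (2 ^ (K + 1))) := by
      refine Submodule.span_mono (Set.image_mono (Set.Iio_subset_Iio ?_)) hk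
      exact Nat.pow_le_pow_right (by norm_num) (by omega)
    have hs := T.node_split (m := m / 2) (by omega)
    rcases Nat.even_or_odd' m with ⟨k, rfl | rfl⟩
    · have e : 2 * k / 2 = k := by omega
      rw [e] at hk' hj hs
      have : T.node (2 * k) = (2⁻¹ : ℝ) • (T.node k + T.jump k) := by
        rw [hs, jump]; ext x; simp; ring
      rw [this]
      exact Submodule.smul_mem _ _ (add_mem hk' hj)
    · have e : (2 * k + 1) / 2 = k := by omega
      rw [e] at hk' hj hs
      have : T.node (2 * k + 1) = (2⁻¹ : ℝ) • (T.node k - T.jump k) := by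
        rw [hs, jump]; ext x; simp; ring
      rw [this]
      exact Submodule.smul_mem _ _ (sub_mem hk' hj)

/-- All nodes are in the span of the Walsh system. -/
theorem node_mem_span_walsh (T : IsDyadicTree μ I v) (m : ℕ) (hm : 1 ≤ m) :
    T.node m ∈ Submodule.span ℝ (Set.range T.walsh) := by
  refine Submodule.span_mono (Set.image_subset_range _ _) (T.node_mem_span_walsh_lt
    (Nat.log 2 m) m (Nat.pow_log_le_self 2 (by omega)) ?_)
  have := Nat.lt_pow_succ_log_self (b := 2) (by norm_num) m
  rw [pow_succ] at this
  omega

end IsDyadicTree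
/-! ### Orthogonal mixing of a block -/

theorem intg_mul_eq_zero_of_mem_span {s t : Set (boundedMeasurable X)}
    (h : ∀ f ∈ s, ∀ g ∈ t, intg μ (f * g) = 0) {f g : boundedMeasurable X}
    (hf : f ∈ Submodule.span ℝ s) (hg : g ∈ Submodule.span ℝ t) : intg μ (f * g) = 0 := by
  induction hf using Submodule.span_induction with
  | mem f hf =>
    induction hg using Submodule.span_induction with
    | mem g hg => exact h f hf g hg
    | zero => simp
    | add g g' _ _ h h' => rw [mul_add, map_add, h, h', add_zero]
    | smul a g _ h => rw [mul_smul_comm, map_smul, h, smul_zero]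
  | zero => simp
  | add f f' _ _ h h' => rw [add_mul, map_add, h, h', add_zero]
  | smul a f _ h => rw [smul_mul_assoc, map_smul, h, smul_zero]

theorem apply_eq_zero_of_mem_span {s : Set (boundedMeasurable X)} {x : X}
    (h : ∀ f ∈ s, f x = 0) {f : boundedMeasurable X} (hf : f ∈ Submodule.span ℝ s) : f x = 0 := by
  induction hf using Submodule.span_induction with
  | mem f hf => exact h f hf
  | zero => simp
  | add f f' _ _ h h' => rw [val_add, h, h', add_zero]
  | smul a f _ h => rw [val_smul, h, mul_zero]

/-- Olevskii's mixing: an unbounded normalised function `g` and `2 ^ p - 1` bounded orthonormal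
functions `r j` are replaced by `2 ^ p` functions with the same span. Each step replaces `g` by
the two functions `(g ± r 0) / √2`, which are then treated in the same way with the odd and the
even remaining `r j`. The share of `g` in each of the final functions is `2 ^ (-p / 2)`, and the
shares of the `r j` sum to a geometric series. -/
theorem exists_mix (p : ℕ) : ∀ (g : boundedMeasurable X) (r : ℕ → boundedMeasurable X) (G R : ℝ),
    intg μ (g * g) = 1 → (∀ i, intg μ (g * r i) = 0) →
    (∀ i j, intg μ (r i * r j) = if i = j then 1 else 0) →
    (∀ x, |g x| ≤ G) → (∀ i x, |r i x| ≤ R) →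
    ∃ ψ : ℕ → boundedMeasurable X,
      (∀ i < 2 ^ p, ∀ j < 2 ^ p, intg μ (ψ i * ψ j) = if i = j then 1 else 0) ∧
      (∀ i < 2 ^ p, ψ i ∈ Submodule.span ℝ (insert g (r '' Set.Iio (2 ^ p - 1)))) ∧
      g ∈ Submodule.span ℝ (ψ '' Set.Iio (2 ^ p)) ∧
      (∀ j < 2 ^ p - 1, r j ∈ Submodule.span ℝ (ψ '' Set.Iio (2 ^ p))) ∧
      (∀ i < 2 ^ p, ∀ x, |ψ i x| ≤ (√2)⁻¹ ^ p * G + 3 * R * (1 - (√2)⁻¹ ^ p)) := by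
  induction p with
  | zero =>
    intro g r G R hg _ _ hG _
    refine ⟨fun _ => g, ?_, ?_, ?_, ?_, ?_⟩
    · intro i hi j hj
      rw [if_pos (by omega), hg]
    · exact fun i _ => Submodule.subset_span (Set.mem_insert _ _)
    · exact Submodule.subset_span ⟨0, by simp, rfl⟩
    · intro j hj; simp at hj
    · intro i _ x; simpa using hG x
  | succ p ih =>
    intro g r G R hg hgr hr hG hR
    have hs : √2 ≠ 0 := by positivity
    have hss : (√2)⁻¹ * (√2)⁻¹ = (2 : ℝ)⁻¹ := by
      rw [← mul_inv, Real.mul_self_sqrt (by norm_num)]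
    have hrg : ∀ i, intg μ (r i * g) = 0 := fun i => by rw [mul_comm]; exact hgr i
    have hG' : ∀ x, |((√2)⁻¹ • (g + r 0)) x| ≤ (√2)⁻¹ * (G + R) := fun x => by
      rw [val_smul, abs_mul, abs_of_pos (by positivity : (0 : ℝ) < (√2)⁻¹)]
      exact mul_le_mul_of_nonneg_left ((abs_add_le _ _).trans (add_le_add (hG x) (hR 0 x)))
        (by positivity)
    have hG'' : ∀ x, |((√2)⁻¹ • (g - r 0)) x| ≤ (√2)⁻¹ * (G + R) := fun x => by
      rw [val_smul, abs_mul, abs_of_pos (by positivity : (0 : ℝ) < (√2)⁻¹)]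
      exact mul_le_mul_of_nonneg_left ((abs_sub _ _).trans (add_le_add (hG x) (hR 0 x)))
        (by positivity)
    obtain ⟨ψ₁, o₁, m₁, g₁, r₁, b₁⟩ := ih ((√2)⁻¹ • (g + r 0)) (fun j => r (2 * j + 1))
      ((√2)⁻¹ * (G + R)) R
      (by
        rw [smul_mul_smul_comm, hss]
        simp only [add_mul, mul_add, map_smul, map_add, hg, hgr, hrg, hr]
        norm_num)
      (fun i => by simp [add_mul, hgr, hr])
      (fun i j => by rw [hr]; congr 1; simp) hG' (fun i x => hR _ x)
    obtain ⟨ψ₂, o₂, m₂, g₂, r₂, b₂⟩ := ih ((√2)⁻¹ • (g - r 0)) (fun j => r (2 * j + 2))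
      ((√2)⁻¹ * (G + R)) R
      (by
        rw [smul_mul_smul_comm, hss]
        simp only [sub_mul, mul_sub, map_smul, map_sub, hg, hgr, hrg, hr]
        norm_num)
      (fun i => by simp [sub_mul, hgr, hr])
      (fun i j => by rw [hr]; congr 1; simp) hG'' (fun i x => hR _ x)
    have hp : 1 ≤ 2 ^ p := Nat.one_le_two_pow
    have hp2 : 2 ^ (p + 1) = 2 ^ p + 2 ^ p := by rw [pow_succ]; ring
    have cross : ∀ i < 2 ^ p, ∀ j < 2 ^ p, intg μ (ψ₁ i * ψ₂ j) = 0 := by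
      intro i hi j hj
      refine intg_mul_eq_zero_of_mem_span μ ?_ (m₁ i hi) (m₂ j hj)
      rintro _ (rfl | ⟨a, -, rfl⟩) _ (rfl | ⟨b, -, rfl⟩)
      · rw [smul_mul_smul_comm]
        simp [add_mul, mul_sub, hg, hgr, hrg, hr]
      · simp [add_mul, hgr, hr]
      · simp [mul_sub, hrg, hr]
      · rw [hr, if_neg (by omega)]
    set ψ : ℕ → boundedMeasurable X := fun i => if i < 2 ^ p then ψ₁ i else ψ₂ (i - 2 ^ p) with hψ
    have e₁ : ∀ i < 2 ^ p, ψ i = ψ₁ i := fun i hi => if_pos hi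
    have e₂ : ∀ i, ψ (2 ^ p + i) = ψ₂ i := fun i => by
      simp only [hψ]; rw [if_neg (by omega), Nat.add_sub_cancel_left]
    have cases : ∀ i < 2 ^ (p + 1), i < 2 ^ p ∨ ∃ j < 2 ^ p, i = 2 ^ p + j := by
      intro i hi
      rcases lt_or_ge i (2 ^ p) with h | h
      · exact Or.inl h
      · exact Or.inr ⟨i - 2 ^ p, by omega, by omega⟩
    have s₁ : Submodule.span ℝ (ψ₁ '' Set.Iio (2 ^ p)) ≤
        Submodule.span ℝ (ψ '' Set.Iio (2 ^ (p + 1))) := by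
      refine Submodule.span_mono ?_
      rintro _ ⟨i, hi, rfl⟩
      rw [Set.mem_Iio] at hi
      exact ⟨i, by rw [Set.mem_Iio]; omega, e₁ i hi⟩
    have s₂ : Submodule.span ℝ (ψ₂ '' Set.Iio (2 ^ p)) ≤
        Submodule.span ℝ (ψ '' Set.Iio (2 ^ (p + 1))) := by
      refine Submodule.span_mono ?_
      rintro _ ⟨i, hi, rfl⟩
      rw [Set.mem_Iio] at hi
      exact ⟨2 ^ p + i, by rw [Set.mem_Iio]; omega, e₂ i⟩
    have mg : g ∈ Submodule.span ℝ (insert g (r '' Set.Iio (2 ^ (p + 1) - 1))) :=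
      Submodule.subset_span (Set.mem_insert _ _)
    have mr : ∀ j < 2 ^ (p + 1) - 1,
        r j ∈ Submodule.span ℝ (insert g (r '' Set.Iio (2 ^ (p + 1) - 1))) :=
      fun j hj => Submodule.subset_span (Set.mem_insert_of_mem _ ⟨j, hj, rfl⟩)
    refine ⟨ψ, ?_, ?_, ?_, ?_, ?_⟩
    · intro i hi j hj
      rcases cases i hi with h | ⟨i, h, rfl⟩ <;> rcases cases j hj with h' | ⟨j, h', rfl⟩
      · rw [e₁ i h, e₁ j h', o₁ i h j h']
      · rw [e₁ i h, e₂, cross i h j h', if_neg (by omega)]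
      · rw [e₂, e₁ j h', mul_comm, cross j h' i h, if_neg (by omega)]
      · rw [e₂, e₂, o₂ i h j h']; simp
    · intro i hi
      rcases cases i hi with h | ⟨i, h, rfl⟩
      · rw [e₁ i h]
        refine Submodule.span_le.2 ?_ (m₁ i h)
        rintro _ (rfl | ⟨a, ha, rfl⟩)
        · exact Submodule.smul_mem _ _ (add_mem mg (mr 0 (by omega)))
        · rw [Set.mem_Iio] at ha
          exact mr _ (by omega)
      · rw [e₂]
        refine Submodule.span_le.2 ?_ (m₂ i h)
        rintro _ (rfl | ⟨a, ha, rfl⟩)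
        · exact Submodule.smul_mem _ _ (sub_mem mg (mr 0 (by omega)))
        · rw [Set.mem_Iio] at ha
          exact mr _ (by omega)
    · have : g = (√2)⁻¹ • ((√2)⁻¹ • (g + r 0) + (√2)⁻¹ • (g - r 0)) := by
        ext x
        simp only [val_smul, val_add, val_sub]
        linear_combination (-2 * g x) * hss
      rw [this]
      exact Submodule.smul_mem _ _ (add_mem (s₁ g₁) (s₂ g₂))
    · intro j hj
      rcases Nat.eq_zero_or_pos j with rfl | hj0
      · have : r 0 = (√2)⁻¹ • ((√2)⁻¹ • (g + r 0) - (√2)⁻¹ • (g - r 0)) := by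
          ext x
          simp only [val_smul, val_add, val_sub]
          linear_combination (-2 * r 0 x) * hss
        rw [this]
        exact Submodule.smul_mem _ _ (sub_mem (s₁ g₁) (s₂ g₂))
      · rcases Nat.even_or_odd' j with ⟨k, rfl | rfl⟩
        · have := s₂ (r₂ (k - 1) (by omega))
          rwa [show 2 * (k - 1) + 2 = 2 * k by omega] at this
        · exact s₁ (r₁ k (by omega))
    · -- `4 / √2 ≤ 3` is what makes the constant `3` of the bound reproduce itself
      have hq : 4 * (√2)⁻¹ ≤ (3 : ℝ) := by
        rw [← div_eq_mul_inv, div_le_iff₀ (by positivity)]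
        have : (4 / 3 : ℝ) ≤ √2 := Real.le_sqrt_of_sq_le (by norm_num)
        linarith
      have key : ∀ x : X, (√2)⁻¹ ^ p * ((√2)⁻¹ * (G + R)) + 3 * R * (1 - (√2)⁻¹ ^ p) ≤
          (√2)⁻¹ ^ (p + 1) * G + 3 * R * (1 - (√2)⁻¹ ^ (p + 1)) := by
        intro x
        have hR0 : 0 ≤ R := (abs_nonneg _).trans (hR 0 x)
        have : 0 ≤ (√2)⁻¹ ^ p * R * (3 - 4 * (√2)⁻¹) :=
          mul_nonneg (by positivity) (by linarith)
        rw [pow_succ]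
        linarith
      intro i hi x
      rcases cases i hi with h | ⟨i, h, rfl⟩
      · rw [e₁ i h]
        exact (b₁ i h x).trans (key x)
      · rw [e₂]
        exact (b₂ i h x).trans (key x)

/-- The mixing of one block. The function `h`, of size up to `√M`, is spread evenly over the `M`
functions `e i + (h - g) / √M`, `i < M`, where `g = (∑ i < M, e i) / √M` is the unit vector that
`h` replaces. The function `g`, again of size `√M`, is mixed with `e M, …, e (2M - 2)` by
`exists_mix`. Where all `e i` vanish, only the first `M` functions contribute to the partial sums
of the kernel, and these are controlled by the `L¹` norms of the partial sums of `e i`. -/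
theorem exists_block (p : ℕ) (h : boundedMeasurable X) (e : ℕ → boundedMeasurable X) (A R L : ℝ)
    (hh : intg μ (h * h) = 1) (hhe : ∀ i, intg μ (h * e i) = 0)
    (he : ∀ i j, intg μ (e i * e j) = if i = j then 1 else 0)
    (hA : ∀ x, |h x| ≤ √(2 ^ p) * A) (hR : ∀ i x, |e i x| ≤ R)
    (hL : ∀ m ≤ 2 ^ p, l1 μ (∑ i ∈ Finset.range m, e i) ≤ L) :
    ∃ ψ : ℕ → boundedMeasurable X,
      (∀ i < 2 ^ (p + 1), ∀ j < 2 ^ (p + 1), intg μ (ψ i * ψ j) = if i = j then 1 else 0) ∧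
      (∀ i < 2 ^ (p + 1), ψ i ∈ Submodule.span ℝ (insert h (e '' Set.Iio (2 ^ (p + 1) - 1)))) ∧
      h ∈ Submodule.span ℝ (ψ '' Set.Iio (2 ^ (p + 1))) ∧
      (∀ j < 2 ^ (p + 1) - 1, e j ∈ Submodule.span ℝ (ψ '' Set.Iio (2 ^ (p + 1)))) ∧
      (∀ i < 2 ^ (p + 1), ∀ x, |ψ i x| ≤ 4 * R + A) ∧
      (∀ x, (∀ i, e i x = 0) → ∑ i ∈ Finset.range (2 ^ (p + 1)), ψ i x • ψ i = h x • h) ∧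
      (∀ x, (∀ i, e i x = 0) → ∀ m ≤ 2 ^ (p + 1), l1 μ (∑ i ∈ Finset.range m, ψ i x • ψ i) ≤
        |h x| * l1 μ h + 2 * (√(2 ^ p))⁻¹ * |h x| * L) := by
  have hM : (0 : ℝ) < 2 ^ p := by positivity
  set s : ℝ := √(2 ^ p) with hsdef
  have hs : 0 < s := Real.sqrt_pos.2 hM
  have hss : s * s = 2 ^ p := Real.mul_self_sqrt hM.le
  set D : boundedMeasurable X := ∑ i ∈ Finset.range (2 ^ p), e i with hD
  have hDR : ∀ x, |D x| ≤ 2 ^ p * R := by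
    intro x
    rw [hD, val_sum]
    refine (Finset.abs_sum_le_sum_abs _ _).trans ?_
    refine (Finset.sum_le_sum fun i _ => hR i x).trans ?_
    simp
  have heD : ∀ i < 2 ^ p, intg μ (e i * D) = 1 := by
    intro i hi
    rw [hD, Finset.mul_sum, map_sum]
    simp [he, hi]
  have heD' : ∀ i, 2 ^ p ≤ i → intg μ (e i * D) = 0 := by
    intro i hi
    rw [hD, Finset.mul_sum, map_sum]
    simp [he, hi]
  have hDD : intg μ (D * D) = 2 ^ p := by
    conv_lhs => enter [2, 1]; rw [hD]
    rw [Finset.sum_mul, map_sum, Finset.sum_congr rfl fun i hi => heD i (Finset.mem_range.1 hi)]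
    simp
  have hhD : intg μ (h * D) = 0 := by
    rw [hD, Finset.mul_sum, map_sum]
    simp [hhe]
  set g : boundedMeasurable X := s⁻¹ • D with hg
  have hsg : ∀ x, |g x| ≤ s * R := by
    intro x
    rw [hg, val_smul, abs_mul, abs_of_pos (inv_pos.2 hs), inv_mul_le_iff₀ hs, ← mul_assoc, hss]
    exact hDR x
  have hgg : intg μ (g * g) = 1 := by
    rw [hg, smul_mul_smul_comm, map_smul, hDD, smul_eq_mul, ← hss]
    field_simp
  have hge : ∀ i < 2 ^ p, intg μ (e i * g) = s⁻¹ := fun i hi => by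
    rw [hg, mul_smul_comm, map_smul, heD i hi, smul_eq_mul, mul_one]
  have hge' : ∀ i, 2 ^ p ≤ i → intg μ (e i * g) = 0 := fun i hi => by
    rw [hg, mul_smul_comm, map_smul, heD' i hi, smul_zero]
  have hhg : intg μ (h * g) = 0 := by
    rw [hg, mul_smul_comm, map_smul, hhD, smul_zero]
  obtain ⟨χ, oχ, mχ, gχ, rχ, bχ⟩ := exists_mix μ p g (fun j => e (2 ^ p + j)) (s * R) R hgg
    (fun i => by rw [mul_comm]; exact hge' _ (by omega))
    (fun i j => by rw [he]; congr 1; simp) hsg (fun i x => hR _ x)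
  set φ : ℕ → boundedMeasurable X := fun i => e i + s⁻¹ • (h - g) with hφ
  have hp : 1 ≤ 2 ^ p := Nat.one_le_two_pow
  have hp2 : 2 ^ (p + 1) = 2 ^ p + 2 ^ p := by rw [pow_succ]; ring
  have oφ : ∀ i < 2 ^ p, ∀ j < 2 ^ p, intg μ (φ i * φ j) = if i = j then 1 else 0 := by
    intro i hi j hj
    have h1 : φ i * φ j = e i * e j + s⁻¹ • (h * e i + h * e j - e i * g - e j * g) +
        (s⁻¹ * s⁻¹) • (h * h - (2 : ℝ) • (h * g) + g * g) := by
      ext x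
      simp only [hφ, val_mul, val_add, val_smul, val_sub]
      ring
    rw [h1]
    simp only [map_add, map_smul, map_sub, he, hhe, hge i hi, hge j hj, hh, hhg, hgg, smul_eq_mul]
    ring
  have gφ : ∀ i < 2 ^ p, intg μ (φ i * g) = 0 := by
    intro i hi
    simp only [hφ, add_mul, smul_mul_assoc, sub_mul, map_add, map_smul, map_sub, hge i hi, hhg,
      hgg, smul_eq_mul]
    ring
  have eφ : ∀ i < 2 ^ p, ∀ j, intg μ (φ i * e (2 ^ p + j)) = 0 := by
    intro i hi j
    have : intg μ (g * e (2 ^ p + j)) = 0 := by rw [mul_comm]; exact hge' _ (by omega)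
    simp only [hφ, add_mul, smul_mul_assoc, sub_mul, map_add, map_smul, map_sub, this, hhe, he,
      smul_eq_mul]
    rw [if_neg (by omega)]
    ring
  have cross : ∀ i < 2 ^ p, ∀ j < 2 ^ p, intg μ (φ i * χ j) = 0 := by
    intro i hi j hj
    refine intg_mul_eq_zero_of_mem_span μ (s := {φ i}) ?_ (Submodule.mem_span_singleton_self _)
      (mχ j hj)
    rintro _ rfl _ (rfl | ⟨b, -, rfl⟩)
    · exact gφ i hi
    · exact eφ i hi b
  have vanish : ∀ x, (∀ i, e i x = 0) → g x = 0 ∧ ∀ j < 2 ^ p, χ j x = 0 := by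
    intro x hx
    have h1 : g x = 0 := by rw [hg, val_smul, hD, val_sum]; simp [hx]
    refine ⟨h1, fun j hj => apply_eq_zero_of_mem_span ?_ (mχ j hj)⟩
    rintro _ (rfl | ⟨b, -, rfl⟩)
    · exact h1
    · exact hx _
  set ψ : ℕ → boundedMeasurable X := fun i => if i < 2 ^ p then φ i else χ (i - 2 ^ p) with hψ
  have e₁ : ∀ i < 2 ^ p, ψ i = φ i := fun i hi => if_pos hi
  have e₂ : ∀ i, ψ (2 ^ p + i) = χ i := fun i => by
    simp only [hψ]; rw [if_neg (by omega), Nat.add_sub_cancel_left]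
  have cases : ∀ i < 2 ^ (p + 1), i < 2 ^ p ∨ ∃ j < 2 ^ p, i = 2 ^ p + j := by
    intro i hi
    rcases lt_or_ge i (2 ^ p) with h | h
    · exact Or.inl h
    · exact Or.inr ⟨i - 2 ^ p, by omega, by omega⟩
  -- the partial sums of the kernel over the first half of the block
  have kernel : ∀ x, (∀ i, e i x = 0) → ∀ m ≤ 2 ^ p, ∑ i ∈ Finset.range m, ψ i x • ψ i =
      ((m / 2 ^ p : ℝ) * h x) • h +
        (s⁻¹ * h x) • (∑ i ∈ Finset.range m, e i - (m / 2 ^ p : ℝ) • D) := by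
    intro x hx m hm
    have h1 : ∀ i ∈ Finset.range m, ψ i x • ψ i = (s⁻¹ * h x) • (e i + s⁻¹ • (h - g)) := by
      intro i hi
      rw [e₁ i ((Finset.mem_range.1 hi).trans_le hm)]
      congr 1
      simp [hφ, hx, (vanish x hx).1]
    rw [Finset.sum_congr rfl h1, ← Finset.smul_sum, Finset.sum_add_distrib, Finset.sum_const,
      Finset.card_range]
    ext y
    simp only [val_smul, val_add, val_sub, hg, ← Nat.cast_smul_eq_nsmul ℝ, ← hss]
    field_simp
    ring
  have kernel_full : ∀ x, (∀ i, e i x = 0) → ∀ m ≤ 2 ^ p,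
      ∑ i ∈ Finset.range (2 ^ p + m), ψ i x • ψ i = h x • h := by
    intro x hx m hm
    rw [Finset.sum_range_add, kernel x hx _ le_rfl, Finset.sum_eq_zero (s := Finset.range m)]
    · push_cast
      rw [div_self hM.ne', one_mul, one_smul, ← hD, sub_self, smul_zero, add_zero, add_zero]
    · intro j hj
      rw [e₂, (vanish x hx).2 j ((Finset.mem_range.1 hj).trans_le hm), zero_smul]
  have hL0 : 0 ≤ L := (l1_nonneg μ _).trans (hL 0 (by omega))
  have s₁ : ∀ i < 2 ^ p, φ i ∈ Submodule.span ℝ (ψ '' Set.Iio (2 ^ (p + 1))) := fun i hi =>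
    Submodule.subset_span ⟨i, by rw [Set.mem_Iio]; omega, e₁ i hi⟩
  have s₂ : Submodule.span ℝ (χ '' Set.Iio (2 ^ p)) ≤
      Submodule.span ℝ (ψ '' Set.Iio (2 ^ (p + 1))) := by
    refine Submodule.span_mono ?_
    rintro _ ⟨i, hi, rfl⟩
    rw [Set.mem_Iio] at hi
    exact ⟨2 ^ p + i, by rw [Set.mem_Iio]; omega, e₂ i⟩
  have hmem : h ∈ Submodule.span ℝ (ψ '' Set.Iio (2 ^ (p + 1))) := by
    have : h = s⁻¹ • ∑ i ∈ Finset.range (2 ^ p), φ i := by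
      rw [hφ, Finset.sum_add_distrib, ← hD, Finset.sum_const, Finset.card_range]
      ext x
      simp only [val_smul, val_add, val_sub, hg, ← Nat.cast_smul_eq_nsmul ℝ]
      push_cast
      rw [← hss]
      field_simp
      ring
    rw [this]
    exact Submodule.smul_mem _ _ (sum_mem fun i hi => s₁ i (Finset.mem_range.1 hi))
  refine ⟨ψ, ?_, ?_, ?_, ?_, ?_, ?_, ?_⟩
  · intro i hi j hj
    rcases cases i hi with h | ⟨i, h, rfl⟩ <;> rcases cases j hj with h' | ⟨j, h', rfl⟩
    · rw [e₁ i h, e₁ j h', oφ i h j h']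
    · rw [e₁ i h, e₂, cross i h j h', if_neg (by omega)]
    · rw [e₂, e₁ j h', mul_comm, cross j h' i h, if_neg (by omega)]
    · rw [e₂, e₂, oχ i h j h']; simp
  · have me : ∀ j < 2 ^ (p + 1) - 1,
        e j ∈ Submodule.span ℝ (insert h (e '' Set.Iio (2 ^ (p + 1) - 1))) :=
      fun j hj => Submodule.subset_span (Set.mem_insert_of_mem _ ⟨j, hj, rfl⟩)
    have mh : h ∈ Submodule.span ℝ (insert h (e '' Set.Iio (2 ^ (p + 1) - 1))) :=
      Submodule.subset_span (Set.mem_insert _ _)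
    have mg : g ∈ Submodule.span ℝ (insert h (e '' Set.Iio (2 ^ (p + 1) - 1))) :=
      Submodule.smul_mem _ _ (sum_mem fun i hi => me i (by
        have := Finset.mem_range.1 hi
        omega))
    intro i hi
    rcases cases i hi with h' | ⟨i, h', rfl⟩
    · rw [e₁ i h']
      exact add_mem (me i (by omega)) (Submodule.smul_mem _ _ (sub_mem mh mg))
    · rw [e₂]
      refine Submodule.span_le.2 ?_ (mχ i h')
      rintro _ (rfl | ⟨a, ha, rfl⟩)
      · exact mg
      · rw [Set.mem_Iio] at ha
        exact me _ (by omega)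
  · exact hmem
  · intro j hj
    rcases cases j (by omega) with h' | ⟨j, h', rfl⟩
    · have : e j = φ j - s⁻¹ • (h - g) := by simp [hφ]
      rw [this]
      exact sub_mem (s₁ j h') (Submodule.smul_mem _ _ (sub_mem hmem (s₂ gχ)))
    · exact s₂ (rχ j (by omega))
  · intro i hi x
    have hR0 : 0 ≤ R := (abs_nonneg _).trans (hR 0 x)
    have hA0 : 0 ≤ A := nonneg_of_mul_nonneg_right ((abs_nonneg _).trans (hA x)) hs
    rcases cases i hi with h' | ⟨i, h', rfl⟩
    · rw [e₁ i h', hφ]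
      have h1 : |s⁻¹ * (h x - g x)| ≤ A + R := by
        rw [abs_mul, abs_of_pos (inv_pos.2 hs), inv_mul_le_iff₀ hs, mul_add]
        exact (abs_sub _ _).trans (add_le_add (hA x) (hsg x))
      have := (abs_add_le (e i x) (s⁻¹ * (h x - g x))).trans (add_le_add (hR i x) h1)
      refine this.trans ?_
      linarith
    · rw [e₂]
      refine (bχ i h' x).trans ?_
      have h1 : (√2)⁻¹ ^ p * s = (1 : ℝ) := by
        have : s = √2 ^ p := by
          rw [hsdef, Real.sqrt_eq_iff_mul_self_eq (by positivity) (by positivity), ← mul_pow,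
            Real.mul_self_sqrt (by norm_num)]
        rw [this, ← mul_pow, inv_mul_cancel₀ (by positivity), one_pow]
      rw [← mul_assoc, h1]
      have : 0 ≤ 3 * R * (√2)⁻¹ ^ p := by positivity
      linarith
  · intro x hx
    rw [hp2]
    exact kernel_full x hx _ le_rfl
  · intro x hx m hm
    rcases le_total m (2 ^ p) with h' | h'
    · rw [kernel x hx m h']
      have hm1 : (m / 2 ^ p : ℝ) ≤ 1 := by
        rw [div_le_one hM]
        exact_mod_cast h'
      have hm0 : (0 : ℝ) ≤ m / 2 ^ p := by positivity
      refine (l1_add_le μ _ _).trans (add_le_add ?_ ?_)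
      · rw [l1_smul, abs_mul, abs_of_nonneg hm0]
        exact mul_le_mul_of_nonneg_right (mul_le_of_le_one_left (abs_nonneg _) hm1)
          (l1_nonneg μ _)
      · rw [l1_smul, abs_mul, abs_of_pos (inv_pos.2 hs)]
        have h2 := l1_sub_le μ (∑ i ∈ Finset.range m, e i) ((m / 2 ^ p : ℝ) • D)
        have h3 : l1 μ ((m / 2 ^ p : ℝ) • D) ≤ L := by
          rw [l1_smul, abs_of_nonneg hm0]
          exact (mul_le_of_le_one_left (l1_nonneg μ _) hm1).trans (hL _ le_rfl)
        have h4 := hL m h'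
        calc _ ≤ s⁻¹ * |h x| * (L + L) :=
              mul_le_mul_of_nonneg_left (by linarith) (by positivity)
          _ = _ := by ring
    · obtain ⟨j, rfl⟩ := Nat.exists_eq_add_of_le h'
      rw [kernel_full x hx j (by omega), l1_smul]
      have : 0 ≤ 2 * s⁻¹ * |h x| * L := by positivity
      linarith

/-! ### The bounded orthonormal system -/

/-- Concatenation of the finite sequences `ψ k 0, …, ψ k (ℓ k - 1)`, `k = 0, 1, …`. -/
theorem exists_concat {α : Type*} (ℓ : ℕ → ℕ) (hℓ : ∀ k, 0 < ℓ k) (ψ : ℕ → ℕ → α) :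
    ∃ φ : ℕ → α, (∀ k, ∀ j < ℓ k, φ (∑ i ∈ Finset.range k, ℓ i + j) = ψ k j) ∧
      ∀ n, ∃ k, ∃ j < ℓ k, n = ∑ i ∈ Finset.range k, ℓ i + j := by
  have cover : ∀ n, ∃ k, ∃ j < ℓ k, n = ∑ i ∈ Finset.range k, ℓ i + j := by
    intro n
    induction n with
    | zero => exact ⟨0, 0, hℓ 0, by simp⟩
    | succ n ih =>
      obtain ⟨k, j, hj, rfl⟩ := ih
      rcases lt_or_ge (j + 1) (ℓ k) with h | h
      · exact ⟨k, j + 1, h, by ring⟩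
      · exact ⟨k + 1, 0, hℓ _, by rw [Finset.sum_range_succ]; omega⟩
  have lt : ∀ k k' j j', j < ℓ k → k < k' →
      ∑ i ∈ Finset.range k, ℓ i + j < ∑ i ∈ Finset.range k', ℓ i + j' := by
    intro k k' j j' hj hk
    have : ∑ i ∈ Finset.range (k + 1), ℓ i ≤ ∑ i ∈ Finset.range k', ℓ i :=
      Finset.sum_le_sum_of_subset (Finset.range_mono hk)
    rw [Finset.sum_range_succ] at this
    omega
  choose κ ι hι hn using cover
  refine ⟨fun n => ψ (κ n) (ι n), ?_, fun n => ⟨κ n, ι n, hι n, hn n⟩⟩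
  intro k j hj
  have h := hn (∑ i ∈ Finset.range k, ℓ i + j)
  have hι' := hι (∑ i ∈ Finset.range k, ℓ i + j)
  set k' := κ (∑ i ∈ Finset.range k, ℓ i + j)
  set j' := ι (∑ i ∈ Finset.range k, ℓ i + j)
  have hk : k' = k := by
    rcases lt_trichotomy k k' with hlt | heq | hlt
    · exact absurd h (lt _ _ _ _ hj hlt).ne
    · exact heq.symm
    · exact absurd h (lt _ _ _ _ hι' hlt).ne'
  have hj' : j' = j := by rw [hk] at h; omega
  change ψ k' j' = ψ k j
  rw [hk, hj']

/-- The length of the `k`-th block. -/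
def blockLength (k : ℕ) : ℕ := 2 ^ (4 * k + 1)

/-- The index of the first Walsh function that is used in the `k`-th block. -/
def walshStart (k : ℕ) : ℕ := ∑ i ∈ Finset.range k, (blockLength i - 1)

theorem walshStart_le (k : ℕ) : walshStart k ≤ 2 ^ (4 * k) := by
  induction k with
  | zero => simp [walshStart]
  | succ k ih =>
    have : walshStart (k + 1) = walshStart k + (blockLength k - 1) := Finset.sum_range_succ _ _
    rw [this, blockLength, show 4 * (k + 1) = 4 * k + 4 by ring, pow_add _ _ 4, pow_succ]
    omega

theorem walshStart_add_lt {k k' j j' : ℕ} (hk : k < k') (hj : j < blockLength k - 1) :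
    walshStart k + j < walshStart k' + j' := by
  have : walshStart (k + 1) ≤ walshStart k' :=
    Finset.sum_le_sum_of_subset (Finset.range_mono hk)
  rw [walshStart, Finset.sum_range_succ, ← walshStart] at this
  omega

theorem succ_le_two_pow (k : ℕ) : (k : ℝ) + 1 ≤ 2 ^ k := by
  exact_mod_cast Nat.lt_two_pow_self (n := k)

variable {μ} {I J : ℕ → Set X} {v w : ℝ}

/-- A uniformly bounded orthonormal system that spans the Haar functions of one dyadic tree and
the Walsh functions of another, disjoint one, and whose partial sums have bounded Lebesgue
functions on the first tree. -/
theorem exists_bounded_system (S : IsDyadicTree μ I v) (T : IsDyadicTree μ J w)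
    (hd : Disjoint (I 1) (J 1)) :
    ∃ (φ : ℕ → boundedMeasurable X) (C : ℝ),
      (∀ i j, intg μ (φ i * φ j) = if i = j then 1 else 0) ∧
      (∀ k, S.haar k ∈ Submodule.span ℝ (Set.range φ)) ∧
      (∀ k, T.walsh k ∈ Submodule.span ℝ (Set.range φ)) ∧
      (∀ n x, |φ n x| ≤ C) ∧
      ∀ N, ∀ x ∈ I 1, l1 μ (∑ n ∈ Finset.range N, φ n x • φ n) ≤ C := by
  have hw := T.pos
  have hsw : 0 < √w := Real.sqrt_pos.2 hw
  have hsv : 0 < √v := Real.sqrt_pos.2 S.pos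
  set e : ℕ → boundedMeasurable X := fun j => (√w)⁻¹ • T.walsh j with he
  have hee : ∀ i j, intg μ (e i * e j) = if i = j then 1 else 0 := by
    intro i j
    rw [he, smul_mul_smul_comm, map_smul, T.intg_walsh_mul_walsh, ← mul_inv,
      Real.mul_self_sqrt hw.le]
    split_ifs <;> simp [hw.ne']
  have heS : ∀ x ∈ I 1, ∀ j, e j x = 0 := by
    intro x hx j
    rw [he, val_smul, T.walsh_apply_of_notMem j (Set.disjoint_left.1 hd hx), mul_zero]
  have hhe : ∀ i j, intg μ (S.haar i * e j) = 0 := by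
    intro i j
    have : S.haar i * e j = 0 := by
      ext x
      by_cases hx : x ∈ I 1
      · simp [heS x hx]
      · simp [S.haar_apply_of_notMem i hx]
    rw [this, map_zero]
  have sqrt_pow : ∀ k : ℕ, √(2 ^ (4 * k)) = (2 : ℝ) ^ k * 2 ^ k := by
    intro k
    rw [Real.sqrt_eq_iff_mul_self_eq (by positivity) (by positivity)]
    ring
  set L : ℕ → ℝ := fun k => (√w)⁻¹ * (2 * (w * (4 * k + 2))) with hLdef
  have hL : ∀ k, ∀ m ≤ 2 ^ (4 * k),
      l1 μ (∑ i ∈ Finset.range m, e (walshStart k + i)) ≤ L k := by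
    intro k m hm
    have h1 := walshStart_le k
    have h2 : 2 ^ (4 * k + 1) = 2 ^ (4 * k) + 2 ^ (4 * k) := by rw [pow_succ]; ring
    have h3 : ∑ i ∈ Finset.range m, e (walshStart k + i) =
        (√w)⁻¹ • (∑ i ∈ Finset.range (walshStart k + m), T.walsh i -
          ∑ i ∈ Finset.range (walshStart k), T.walsh i) := by
      rw [Finset.sum_range_add, add_sub_cancel_left, Finset.smul_sum]
    rw [h3, l1_smul, abs_of_pos (inv_pos.2 hsw)]
    refine mul_le_mul_of_nonneg_left ((l1_sub_le μ _ _).trans ?_) (by positivity)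
    have h4 := T.l1_sum_walsh_le (4 * k + 1) (walshStart k + m) (by omega)
    have h5 := T.l1_sum_walsh_le (4 * k + 1) (walshStart k) (by omega)
    push_cast at h4 h5
    linarith
  have hA : ∀ k x, |S.haar k x| ≤ √(2 ^ (4 * k)) * (√v)⁻¹ := by
    intro k x
    refine (S.abs_haar_le k x).trans ?_
    rw [mul_comm, sqrt_pow]
    refine mul_le_mul_of_nonneg_right ((succ_le_two_pow k).trans ?_) (by positivity)
    exact le_mul_of_one_le_left (by positivity) (one_le_pow₀ (by norm_num))
  have hR : ∀ i x, |e i x| ≤ (√w)⁻¹ := by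
    intro i x
    rw [he, val_smul, abs_mul, abs_of_pos (inv_pos.2 hsw)]
    exact mul_le_of_le_one_right (by positivity) (T.abs_walsh_le i x)
  have block := fun k => exists_block μ (4 * k) (S.haar k) (fun i => e (walshStart k + i))
    (√v)⁻¹ (√w)⁻¹ (L k) (by rw [S.haar_orthonormal, if_pos rfl]) (fun i => hhe _ _)
    (fun i j => by rw [hee]; congr 1; simp) (hA k) (fun i x => hR _ x) (hL k)
  choose ψ ho hm hh hw' hb hk hk' using block
  obtain ⟨φ, hφ, cover⟩ := exists_concat blockLength (fun k => by unfold blockLength; positivity) ψ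
  have mem : ∀ k, Submodule.span ℝ (ψ k '' Set.Iio (blockLength k)) ≤
      Submodule.span ℝ (Set.range φ) := by
    intro k
    refine Submodule.span_mono ?_
    rintro _ ⟨j, hj, rfl⟩
    exact ⟨_, hφ k j hj⟩
  have walsh_cover : ∀ n, ∃ k, ∃ j < blockLength k - 1, n = walshStart k + j :=
    (exists_concat (fun k => blockLength k - 1)
      (fun k => by
        have : 1 ≤ 2 ^ (4 * k) := Nat.one_le_two_pow
        simp only [blockLength, pow_succ]
        omega) (fun _ _ => 0)).choose_spec.2
  have ortho : ∀ k k', k < k' → ∀ i < blockLength k, ∀ j < blockLength k',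
      intg μ (ψ k i * ψ k' j) = 0 := by
    intro k k' hkk i hi j hj
    refine intg_mul_eq_zero_of_mem_span μ ?_ (hm k i hi) (hm k' j hj)
    rintro _ (rfl | ⟨a, ha, rfl⟩) _ (rfl | ⟨b, -, rfl⟩)
    · rw [S.haar_orthonormal, if_neg hkk.ne]
    · exact hhe _ _
    · rw [mul_comm]; exact hhe _ _
    · rw [hee, if_neg (walshStart_add_lt hkk ha).ne]
  -- the kernel of the first `k` blocks is that of the first `k` Haar functions
  have kernel : ∀ x ∈ I 1, ∀ k, ∑ n ∈ Finset.range (∑ i ∈ Finset.range k, blockLength i),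
      φ n x • φ n = ∑ i ∈ Finset.range k, S.haar i x • S.haar i := by
    intro x hx k
    induction k with
    | zero => simp
    | succ k ih =>
      rw [Finset.sum_range_succ, Finset.sum_range_add, ih, Finset.sum_range_succ,
        ← hk k x fun i => heS x hx _]
      congr 1
      exact Finset.sum_congr rfl fun j hj => by rw [hφ k j (Finset.mem_range.1 hj)]
  have hbd : ∀ k x, 2 * (√(2 ^ (4 * k)))⁻¹ * |S.haar k x| * L k ≤
      16 * ((√v)⁻¹ * (√w)⁻¹ * w) := by
    intro k x
    have h1 := succ_le_two_pow k
    have h2 := S.abs_haar_le k x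
    have h3 : L k ≤ (√w)⁻¹ * (2 * (w * (4 * 2 ^ k))) := by
      refine mul_le_mul_of_nonneg_left ?_ (by positivity)
      refine mul_le_mul_of_nonneg_left ?_ (by positivity)
      refine mul_le_mul_of_nonneg_left ?_ hw.le
      linarith
    have hL0 : 0 ≤ L k := (l1_nonneg μ _).trans (hL k 0 (Nat.zero_le _))
    calc 2 * (√(2 ^ (4 * k)))⁻¹ * |S.haar k x| * L k
        ≤ 2 * (√(2 ^ (4 * k)))⁻¹ * ((√v)⁻¹ * 2 ^ k) * ((√w)⁻¹ * (2 * (w * (4 * 2 ^ k)))) := by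
          refine mul_le_mul (mul_le_mul_of_nonneg_left (h2.trans ?_) (by positivity)) h3 hL0
            (by positivity)
          exact mul_le_mul_of_nonneg_left h1 (by positivity)
      _ = _ := by
          rw [sqrt_pow]
          field_simp
          ring
  refine ⟨φ, 4 * (√w)⁻¹ + (√v)⁻¹ + (2 + 16 * ((√v)⁻¹ * (√w)⁻¹ * w)), ?_, ?_, ?_, ?_, ?_⟩
  · intro m n
    obtain ⟨k, i, hi, rfl⟩ := cover m
    obtain ⟨k', j, hj, rfl⟩ := cover n
    rw [hφ k i hi, hφ k' j hj]
    have ne : ∀ {k k' : ℕ} {i j : ℕ}, i < blockLength k → j < blockLength k' → k < k' →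
        ∑ l ∈ Finset.range k, blockLength l + i ≠ ∑ l ∈ Finset.range k', blockLength l + j := by
      intro k k' i j hi hj hkk
      have : ∑ l ∈ Finset.range (k + 1), blockLength l ≤ ∑ l ∈ Finset.range k', blockLength l :=
        Finset.sum_le_sum_of_subset (Finset.range_mono hkk)
      rw [Finset.sum_range_succ] at this
      omega
    rcases lt_trichotomy k k' with h | rfl | h
    · rw [ortho k k' h i hi j hj, if_neg (ne hi hj h)]
    · rw [ho k i hi j hj]
      simp
    · rw [mul_comm, ortho k' k h j hj i hi, if_neg (ne hj hi h).symm]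
  · exact fun k => mem k (hh k)
  · intro n
    obtain ⟨k, j, hj, rfl⟩ := walsh_cover n
    have h1 := mem k (hw' k j hj)
    have h2 : T.walsh (walshStart k + j) = √w • e (walshStart k + j) := by
      rw [he, smul_inv_smul₀ hsw.ne']
    rw [h2]
    exact Submodule.smul_mem _ _ h1
  · intro n x
    obtain ⟨k, i, hi, rfl⟩ := cover n
    rw [hφ k i hi]
    refine (hb k i hi x).trans (le_add_of_nonneg_right ?_)
    positivity
  · intro N x hx
    obtain ⟨k, m, hm', rfl⟩ := cover N
    rw [Finset.sum_range_add, kernel x hx]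
    have e1 : ∑ j ∈ Finset.range m, φ (∑ i ∈ Finset.range k, blockLength i + j) x •
        φ (∑ i ∈ Finset.range k, blockLength i + j) = ∑ j ∈ Finset.range m, ψ k j x • ψ k j :=
      Finset.sum_congr rfl fun j hj => by
        rw [hφ k j ((Finset.mem_range.1 hj).trans hm')]
    rw [e1]
    refine (l1_add_le μ _ _).trans ?_
    have h1 := S.l1_sum_haar_le k x
    have h2 := hk' k x (fun i => heS x hx _) m hm'.le
    have h3 := S.abs_haar_mul_l1_le k x
    have h4 := hbd k x
    have h5 : 0 ≤ 4 * (√w)⁻¹ + (√v)⁻¹ := by positivity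
    linarith

end System

/-! ### Dyadic intervals -/

open boundedMeasurable PaleyWiener

/-- The dyadic subintervals of `[a, b)` in heap order: for `m = 2 ^ l + j` with `j < 2 ^ l` this is
the `j`-th of the `2 ^ l` intervals of length `(b - a) / 2 ^ l`. -/
def dyadicInterval (a b : ℝ) (m : ℕ) : Set ℝ :=
  Set.Ico (a + (b - a) * (m / 2 ^ Nat.log 2 m - 1)) (a + (b - a) * ((m + 1) / 2 ^ Nat.log 2 m - 1))

theorem dyadicInterval_one (a b : ℝ) : dyadicInterval a b 1 = Set.Ico a b := by
  simp only [dyadicInterval, Nat.log_one_right, pow_zero, Nat.cast_one]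
  norm_num

theorem dyadicInterval_subset {a b : ℝ} (hab : a ≤ b) {m : ℕ} (hm : 1 ≤ m) :
    dyadicInterval a b m ⊆ Set.Ico a b := by
  have h1 : (2 : ℝ) ^ Nat.log 2 m ≤ m := by
    exact_mod_cast Nat.pow_log_le_self 2 (by omega : m ≠ 0)
  have h2 : (m : ℝ) + 1 ≤ 2 * 2 ^ Nat.log 2 m := by
    have := Nat.lt_pow_succ_log_self (b := 2) (by norm_num) m
    rw [pow_succ'] at this
    exact_mod_cast this
  have hp : (0 : ℝ) < 2 ^ Nat.log 2 m := by positivity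
  refine Set.Ico_subset_Ico ?_ ?_
  · have : 1 ≤ (m : ℝ) / 2 ^ Nat.log 2 m := by rwa [one_le_div hp]
    nlinarith
  · have : ((m : ℝ) + 1) / 2 ^ Nat.log 2 m ≤ 2 := by rwa [div_le_iff₀ hp]
    nlinarith

theorem bandMeasure_pi_real_Ico {s t : ℝ} (hs : -Real.pi ≤ s) (hst : s ≤ t) (ht : t ≤ Real.pi) :
    (PaleyWiener.bandMeasure Real.pi).real (Set.Ico s t) = (t - s) / (2 * Real.pi) := by
  have hsub : Set.Ico s t ⊆ Set.Icc (-Real.pi) Real.pi := fun x hx =>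
    ⟨hs.trans hx.1, hx.2.le.trans ht⟩
  rw [PaleyWiener.bandMeasure, measureReal_ennreal_smul_apply,
    measureReal_restrict_apply measurableSet_Ico, Set.inter_eq_left.2 hsub,
    Real.volume_real_Ico_of_le hst, ENNReal.toReal_inv,
    ENNReal.toReal_ofReal (by positivity)]
  ring

theorem isDyadicTree_dyadicInterval {a b : ℝ} (ha : -Real.pi ≤ a) (hab : a < b)
    (hb : b ≤ Real.pi) : IsDyadicTree (PaleyWiener.bandMeasure Real.pi) (dyadicInterval a b)
      ((b - a) / (2 * Real.pi)) where
  pos := div_pos (sub_pos.2 hab) (by positivity)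
  measurableSet _ := measurableSet_Ico
  union m hm := by
    have hp : (0 : ℝ) < 2 ^ Nat.log 2 m := by positivity
    have hba := sub_pos.2 hab
    simp only [dyadicInterval, IsDyadicTree.log_two_mul hm, IsDyadicTree.log_two_mul_add_one hm,
      pow_succ]
    push_cast
    rw [Set.Ico_union_Ico_eq_Ico]
    · congr 4
      · field_simp
      · field_simp; ring
    · gcongr; linarith
    · gcongr; linarith
  disjoint m hm := by
    simp only [dyadicInterval, IsDyadicTree.log_two_mul hm, IsDyadicTree.log_two_mul_add_one hm]
    push_cast
    exact Set.Ico_disjoint_Ico_same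
  measure m hm := by
    have hp : (0 : ℝ) < 2 ^ Nat.log 2 m := by positivity
    have hba := sub_pos.2 hab
    have hlt : a + (b - a) * (m / 2 ^ Nat.log 2 m - 1) <
        a + (b - a) * ((m + 1) / 2 ^ Nat.log 2 m - 1) := by gcongr; linarith
    have hsub := (Set.Ico_subset_Ico_iff hlt).1 (dyadicInterval_subset hab.le hm)
    rw [dyadicInterval, bandMeasure_pi_real_Ico (ha.trans hsub.1) hlt.le (hsub.2.trans hb)]
    field_simp
    ring

/-- An integrable function whose integrals over all dyadic subintervals vanish is zero: its
primitive vanishes at the dyadic points, hence everywhere. -/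
theorem ae_eq_zero_of_dyadicInterval {a b : ℝ} (hab : a < b) {f : ℝ → ℂ}
    (hf : IntegrableOn f (Set.Ico a b))
    (h : ∀ m, 1 ≤ m → ∫ x in dyadicInterval a b m, f x = 0) :
    ∀ᵐ x, x ∈ Set.Ico a b → f x = 0 := by
  set F : ℝ → ℂ := (Set.Ico a b).indicator f with hF
  have hFi : Integrable F := (integrable_indicator_iff measurableSet_Ico).2 hf
  have hba := sub_pos.2 hab
  set Φ : ℝ → ℂ := fun t => ∫ x in a..t, F x with hΦ
  have hΦc : Continuous Φ := intervalIntegral.continuous_primitive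
    (fun _ _ => hFi.intervalIntegrable) a
  have dyadic : ∀ l j : ℕ, j ≤ 2 ^ l → Φ (a + (b - a) * (j / 2 ^ l)) = 0 := by
    intro l j hj
    induction j with
    | zero => simp [hΦ]
    | succ j ih =>
      have e := intervalIntegral.integral_add_adjacent_intervals (μ := volume) (f := F) (a := a)
        (b := a + (b - a) * (j / 2 ^ l)) (c := a + (b - a) * ((j + 1 : ℕ) / 2 ^ l))
        hFi.intervalIntegrable hFi.intervalIntegrable
      have ih' : ∫ x in a..(a + (b - a) * (j / 2 ^ l)), F x = 0 := ih (by omega)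
      have hp : (0 : ℝ) < 2 ^ l := by positivity
      change ∫ x in a..(a + (b - a) * ((j + 1 : ℕ) / 2 ^ l)), F x = 0
      rw [← e, ih', zero_add, intervalIntegral.integral_of_le (by gcongr; linarith),
        ← integral_Ico_eq_integral_Ioc]
      have hm : 1 ≤ 2 ^ l + j := by have := Nat.one_le_two_pow (n := l); omega
      have hlog : Nat.log 2 (2 ^ l + j) = l :=
        (Nat.log_eq_iff (Or.inr ⟨by norm_num, by omega⟩)).2 ⟨by omega, by rw [pow_succ]; omega⟩
      have hI : dyadicInterval a b (2 ^ l + j) =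
          Set.Ico (a + (b - a) * (j / 2 ^ l)) (a + (b - a) * ((j + 1 : ℕ) / 2 ^ l)) := by
        rw [dyadicInterval, hlog]
        push_cast
        congr 4
        · field_simp; ring
        · field_simp; ring
      rw [← hI, hF, setIntegral_indicator measurableSet_Ico,
        Set.inter_eq_left.2 (dyadicInterval_subset hab.le hm)]
      exact h _ hm
  have zero : ∀ t ∈ Set.Ioo a b, Φ t = 0 := by
    intro t ht
    set u := (t - a) / (b - a) with hu
    have hu0 : 0 ≤ u := div_nonneg (by linarith [ht.1]) hba.le
    have hu1 : u ≤ 1 := by rw [div_le_one hba]; linarith [ht.2]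
    have htu : a + (b - a) * u = t := by rw [hu]; field_simp; ring
    have lim : Tendsto (fun l : ℕ => a + (b - a) * ((⌊u * 2 ^ l⌋₊ : ℝ) / 2 ^ l)) atTop (𝓝 t) := by
      rw [← htu]
      refine tendsto_const_nhds.add (tendsto_const_nhds.mul ?_)
      exact (tendsto_nat_floor_mul_div_atTop hu0).comp
        (tendsto_pow_atTop_atTop_of_one_lt (by norm_num : (1 : ℝ) < 2))
    have l2 := (hΦc.tendsto t).comp lim
    have : (Φ ∘ fun l : ℕ => a + (b - a) * ((⌊u * 2 ^ l⌋₊ : ℝ) / 2 ^ l)) = fun _ => 0 := by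
      funext l
      refine dyadic l _ ?_
      have hp : (0 : ℝ) < 2 ^ l := by positivity
      refine Nat.floor_le_of_le ?_
      push_cast
      nlinarith
    rw [this] at l2
    exact (tendsto_nhds_unique l2 tendsto_const_nhds)
  filter_upwards [_root_.LocallyIntegrable.ae_hasDerivAt_integral hFi.locallyIntegrable,
    Measure.ae_ne volume a] with x hx hxa hxm
  have hxo : x ∈ Set.Ioo a b := ⟨lt_of_le_of_ne hxm.1 (Ne.symm hxa), hxm.2⟩
  have h1 : HasDerivAt Φ (F x) x := hx a
  have h2 : Φ =ᶠ[𝓝 x] fun _ => 0 := by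
    filter_upwards [isOpen_Ioo.mem_nhds hxo] with t ht using zero t ht
  have h3 := (h2.hasDerivAt_iff.1 h1).unique (hasDerivAt_const x (0 : ℂ))
  rwa [hF, Set.indicator_of_mem hxm] at h3

/-! ### From Lebesgue functions to bounds on `L¹` -/

section Expansion

variable {X : Type*} [MeasurableSpace X] (μ : Measure X) [IsFiniteMeasure μ]

theorem integrable_mul_coe {F : X → ℂ} (hF : Integrable F μ) (f : boundedMeasurable X) :
    Integrable (fun x => F x * (f x : ℂ)) μ := by
  obtain ⟨C, hC⟩ := f.2.2
  refine hF.mul_bdd (c := C)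
    (Complex.measurable_ofReal.comp (measurable_coe f)).aestronglyMeasurable
    (Eventually.of_forall fun x => ?_)
  rw [Complex.norm_real]
  exact hC x

/-- If the Lebesgue functions of the system `φ` are bounded on `G`, then the partial sums of the
expansions of functions supported in `G` are bounded in `L¹`. -/
theorem integral_norm_sum_le {φ : ℕ → boundedMeasurable X} {C : ℝ} {G : Set X} {N : ℕ}
    (hC : ∀ x ∈ G, l1 μ (∑ n ∈ Finset.range N, φ n x • φ n) ≤ C) {F : X → ℂ}
    (hF : Integrable F μ) (hG : ∀ᵐ x ∂μ, x ∉ G → F x = 0) :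
    ∫ y, ‖∑ n ∈ Finset.range N, (∫ x, F x * (φ n x : ℂ) ∂μ) * (φ n y : ℂ)‖ ∂μ ≤
      C * ∫ x, ‖F x‖ ∂μ := by
  set K : X → X → ℝ := fun x y => ∑ n ∈ Finset.range N, φ n x * φ n y with hK
  choose c hc using fun n => (φ n).2.2
  have hKb : ∀ x y, |K x y| ≤ ∑ n ∈ Finset.range N, c n * c n := by
    intro x y
    refine (Finset.abs_sum_le_sum_abs _ _).trans (Finset.sum_le_sum fun n _ => ?_)
    rw [abs_mul]
    exact mul_le_mul (hc n x) (hc n y) (abs_nonneg _) ((abs_nonneg _).trans (hc n x))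
  have hKm : Measurable (fun z : X × X => |K z.1 z.2|) := by
    have : Measurable (fun z : X × X => K z.1 z.2) :=
      Finset.measurable_fun_sum _ fun n _ =>
        ((measurable_coe (φ n)).comp measurable_fst).mul
          ((measurable_coe (φ n)).comp measurable_snd)
    exact measurable_norm.comp this
  have hprod : Integrable (Function.uncurry fun x y => ‖F x‖ * |K x y|) (μ.prod μ) := by
    refine (hF.norm.comp_fst μ).mul_bdd (c := ∑ n ∈ Finset.range N, c n * c n)
      hKm.aestronglyMeasurable (Eventually.of_forall fun z => ?_)
    rw [Real.norm_eq_abs, abs_abs]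
    exact hKb _ _
  have hsum : ∀ y, ∑ n ∈ Finset.range N, (∫ x, F x * (φ n x : ℂ) ∂μ) * (φ n y : ℂ) =
      ∫ x, F x * (K x y : ℂ) ∂μ := by
    intro y
    simp_rw [← integral_mul_const]
    rw [← integral_finsetSum _ fun n _ => (integrable_mul_coe μ hF (φ n)).mul_const _]
    refine integral_congr_ae (Eventually.of_forall fun x => ?_)
    simp only [hK]
    push_cast
    rw [Finset.mul_sum]
    exact Finset.sum_congr rfl fun n _ => by ring
  have hl1 : ∀ x, ∫ y, |K x y| ∂μ = l1 μ (∑ n ∈ Finset.range N, φ n x • φ n) := by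
    intro x
    unfold l1
    simp only [val_sum, val_smul, hK]
  calc _ ≤ ∫ y, ∫ x, ‖F x‖ * |K x y| ∂μ ∂μ := by
        refine integral_mono_of_nonneg (Eventually.of_forall fun y => norm_nonneg _)
          hprod.integral_prod_right (Eventually.of_forall fun y => ?_)
        simp only
        rw [hsum]
        refine (norm_integral_le_integral_norm _).trans_eq ?_
        refine integral_congr_ae (Eventually.of_forall fun x => ?_)
        simp only
        rw [norm_mul, Complex.norm_real, Real.norm_eq_abs]
    _ = ∫ x, ∫ y, ‖F x‖ * |K x y| ∂μ ∂μ := (integral_integral_swap hprod).symm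
    _ = ∫ x, ‖F x‖ * ∫ y, |K x y| ∂μ ∂μ := by simp_rw [integral_const_mul]
    _ ≤ ∫ x, C * ‖F x‖ ∂μ := by
        refine integral_mono_of_nonneg (Eventually.of_forall fun x =>
          mul_nonneg (norm_nonneg _) (integral_nonneg fun _ => abs_nonneg _))
          (hF.norm.const_mul C) ?_
        filter_upwards [hG] with x hx
        by_cases hxG : x ∈ G
        · rw [hl1, mul_comm]
          exact mul_le_mul_of_nonneg_right (hC x hxG) (norm_nonneg _)
        · simp [hx hxG]
    _ = _ := integral_const_mul _ _

end Expansion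

/-! ### Paley–Wiener spaces -/

instance : IsProbabilityMeasure (bandMeasure Real.pi) := by
  constructor
  have h : (0 : ℝ) < 2 * Real.pi := by positivity
  rw [bandMeasure, Measure.smul_apply, Measure.restrict_apply MeasurableSet.univ,
    Set.univ_inter, Real.volume_Icc, smul_eq_mul, sub_neg_eq_add, ← two_mul]
  exact ENNReal.inv_mul_cancel (by simpa using h) ENNReal.ofReal_ne_top

section PW

variable {p : ℝ≥0∞} [Fact (1 ≤ p)] {σ : ℝ}

/-- The element of `PW^p_σ` with a given spectrum. -/
noncomputable def ofSpectrum (g : ℝ → ℂ) (hg : MemLp g p (bandMeasure σ)) : PW p σ :=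
  ⟨synthesis σ g, g, hg, rfl⟩

theorem hat_ae_eq_of_coe_eq {f : PW p σ} {g : ℝ → ℂ} (hg : IntegrableOn g (Set.Icc (-σ) σ))
    (h : (f : ℂ → ℂ) = synthesis σ g) : f.hat =ᵐ[bandMeasure σ] g :=
  ae_eq_of_synthesis_eq (integrableOn_of_memLp (Lp.memLp _)) hg ((PW.synthesis_hat f).trans h)

theorem hat_ofSpectrum (g : ℝ → ℂ) (hg : MemLp g p (bandMeasure σ)) :
    (ofSpectrum g hg).hat =ᵐ[bandMeasure σ] g :=
  hat_ae_eq_of_coe_eq (integrableOn_of_memLp hg) rfl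

theorem hat_toPW1 (f : PW 2 Real.pi) : f.toPW1.hat =ᵐ[bandMeasure Real.pi] f.hat :=
  hat_ae_eq_of_coe_eq (integrableOn_of_memLp (Lp.memLp _)) (PW.synthesis_hat f).symm

theorem integrable_hat (f : PW p σ) : Integrable f.hat (bandMeasure σ) :=
  (Lp.memLp f.hat).integrable Fact.out

theorem hat_sub (f g : PW p σ) : (f - g).hat =ᵐ[bandMeasure σ] fun x => f.hat x - g.hat x := by
  have h : (f - g).hat = f.hat - g.hat := map_sub (PW.hatₗ (p := p) (σ := σ)) f g
  rw [h]
  exact Lp.coeFn_sub _ _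

theorem norm_eq_integral (f : PW 1 σ) : ‖f‖ = ∫ x, ‖f.hat x‖ ∂(bandMeasure σ) := by
  rw [PW.norm_def, L1.norm_eq_integral_norm]

theorem norm_toPW1_le (f : PW 2 Real.pi) : ‖f.toPW1‖ ≤ ‖f‖ := by
  rw [PW.norm_def, PW.norm_def, Lp.norm_def, Lp.norm_def]
  refine ENNReal.toReal_mono (Lp.eLpNorm_ne_top _) ?_
  rw [eLpNorm_congr_ae (hat_toPW1 f)]
  exact eLpNorm_le_eLpNorm_of_exponent_le (by norm_num) (Lp.aestronglyMeasurable _)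

/-- Evaluation at a point as a linear functional. -/
noncomputable def evalₗ (z : ℂ) : PW p σ →ₗ[ℂ] ℂ where
  toFun f := f z
  map_add' _ _ := rfl
  map_smul' _ _ := rfl

/-- The inclusion `PW^2_π ⊆ PW^1_π` as a linear map. -/
noncomputable def toPW1ₗ : PW 2 Real.pi →ₗ[ℂ] PW 1 Real.pi where
  toFun := PW.toPW1
  map_add' _ _ := rfl
  map_smul' _ _ := rfl

theorem norm_apply_le (f : PW 1 Real.pi) (t : ℝ) : ‖f t‖ ≤ ‖f‖ := by
  rw [norm_eq_integral, ← PW.synthesis_hat f, synthesis, ← PW.integral_bandMeasure_pi]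
  refine (norm_integral_le_integral_norm _).trans_eq ?_
  refine integral_congr_ae (Eventually.of_forall fun ω => ?_)
  simp only
  rw [norm_mul, Complex.norm_exp]
  simp

theorem hat_eq_zero_of_mem_functions {τ : ℝ} (hτ : τ ≤ Real.pi) {f : PW 1 Real.pi}
    (hf : (f : ℂ → ℂ) ∈ functions 1 τ) :
    ∀ᵐ x ∂(bandMeasure Real.pi), x ∉ Set.Icc (-τ) τ → f.hat x = 0 := by
  obtain ⟨g, hg, e⟩ := hf
  have hsub : Set.Icc (-τ) τ ⊆ Set.Icc (-Real.pi) Real.pi :=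
    Set.Icc_subset_Icc (by linarith) hτ
  have hgi : Integrable ((Set.Icc (-τ) τ).indicator g) :=
    (integrable_indicator_iff measurableSet_Icc).2 (integrableOn_of_memLp hg)
  have h : (f : ℂ → ℂ) = synthesis Real.pi ((Set.Icc (-τ) τ).indicator g) := by
    rw [e]
    funext z
    unfold synthesis
    congr 1
    have : (fun ω : ℝ => (Set.Icc (-τ) τ).indicator g ω * Complex.exp (Complex.I * (ω : ℂ) * z)) =
        (Set.Icc (-τ) τ).indicator fun ω : ℝ => g ω * Complex.exp (Complex.I * (ω : ℂ) * z) := by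
      funext ω
      by_cases hω : ω ∈ Set.Icc (-τ) τ
      · simp only [Set.indicator_of_mem hω]
      · simp only [Set.indicator_of_notMem hω, zero_mul]
    rw [this, setIntegral_indicator measurableSet_Icc, Set.inter_eq_right.2 hsub]
  filter_upwards [hat_ae_eq_of_coe_eq hgi.integrableOn h] with x hx hxn
  rw [hx, Set.indicator_of_notMem hxn]

instance : CompleteSpace (PW 2 Real.pi) := by
  have hs : Function.Surjective (PW.hatₗ : PW 2 Real.pi →ₗ[ℂ] _) := fun g =>
    ⟨ofSpectrum g (Lp.memLp g), PW.hat_eq_of_synthesis_eq rfl⟩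
  exact (LinearIsometryEquiv.ofSurjective
    (⟨PW.hatₗ, fun _ => rfl⟩ : PW 2 Real.pi →ₗᵢ[ℂ] Lp ℂ 2 (bandMeasure Real.pi))
    hs).toIsometryEquiv.completeSpace

end PW

/-! ### The basis -/

/-- An element of `PW^2_π` whose spectrum has zero integral over every dyadic subinterval of
`[-π, c)` and of `[c, π)` is zero. -/
theorem eq_zero_of_nodes {c : ℝ} (hc : -Real.pi < c) (hc' : c < Real.pi) {f : PW 2 Real.pi}
    (h₁ : ∀ m, 1 ≤ m → ∫ x, f.hat x *
      ((isDyadicTree_dyadicInterval le_rfl hc hc'.le).node m x : ℂ) ∂(bandMeasure Real.pi) = 0)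
    (h₂ : ∀ m, 1 ≤ m → ∫ x, f.hat x *
      ((isDyadicTree_dyadicInterval hc.le hc' le_rfl).node m x : ℂ) ∂(bandMeasure Real.pi) = 0) :
    f = 0 := by
  have hint : IntegrableOn f.hat (Set.Icc (-Real.pi) Real.pi) :=
    integrableOn_of_memLp (Lp.memLp _)
  have key : ∀ {a b : ℝ} (ha : -Real.pi ≤ a) (hab : a < b) (hb : b ≤ Real.pi),
      (∀ m, 1 ≤ m → ∫ x, f.hat x *
        ((isDyadicTree_dyadicInterval ha hab hb).node m x : ℂ) ∂(bandMeasure Real.pi) = 0) →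
      ∀ᵐ x, x ∈ Set.Ico a b → f.hat x = 0 := by
    intro a b ha hab hb h
    have hsub : Set.Ico a b ⊆ Set.Icc (-Real.pi) Real.pi := fun x hx =>
      ⟨ha.trans hx.1, hx.2.le.trans hb⟩
    refine ae_eq_zero_of_dyadicInterval hab (hint.mono_set hsub) fun m hm => ?_
    have h1 := h m hm
    have e : (fun x => f.hat x * ((isDyadicTree_dyadicInterval ha hab hb).node m x : ℂ)) =
        (dyadicInterval a b m).indicator f.hat := by
      funext x
      by_cases hx : x ∈ dyadicInterval a b m <;> simp [IsDyadicTree.node_apply, hx]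
    have hpi : (1 / (2 * (Real.pi : ℂ))) ≠ 0 := by
      simp [Real.pi_ne_zero]
    rw [e, PW.integral_bandMeasure_pi, setIntegral_indicator
      (show MeasurableSet (dyadicInterval a b m) from measurableSet_Ico),
      Set.inter_eq_right.2 ((dyadicInterval_subset hab.le hm).trans hsub)] at h1
    exact (mul_eq_zero.1 h1).resolve_left hpi
  have hz : f.hat =ᵐ[bandMeasure Real.pi] 0 := by
    refine ae_bandMeasure_of_ae_restrict ((ae_restrict_iff' measurableSet_Icc).2 ?_)
    filter_upwards [key le_rfl hc hc'.le h₁, key hc.le hc' le_rfl h₂,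
      Measure.ae_ne volume Real.pi] with x h1 h2 h3 hx
    rcases lt_or_ge x c with h | h
    · exact h1 ⟨hx.1, h⟩
    · exact h2 ⟨h, lt_of_le_of_ne hx.2 h3⟩
  have : f.hat = 0 := (Lp.eq_zero_iff_ae_eq_zero).2 hz
  rw [← norm_eq_zero, PW.norm_def, this, norm_zero]

/-- An orthonormal basis of `PW^2_π` whose spectra are the functions of
`exists_bounded_system` for the dyadic trees of `[-π, c)` and `[c, π)`. -/
theorem exists_hilbertBasis_bounded {c : ℝ} (hc : -Real.pi < c) (hc' : c < Real.pi) :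
    ∃ (s : HilbertBasis ℕ ℂ (PW 2 Real.pi)) (φ : ℕ → boundedMeasurable ℝ) (C : ℝ),
      (∀ n, (s n).hat =ᵐ[bandMeasure Real.pi] fun x => (φ n x : ℂ)) ∧
      (∀ n x, |φ n x| ≤ C) ∧
      ∀ N, ∀ x ∈ Set.Ico (-Real.pi) c,
        l1 (bandMeasure Real.pi) (∑ n ∈ Finset.range N, φ n x • φ n) ≤ C := by
  set S := isDyadicTree_dyadicInterval le_rfl hc hc'.le with hS
  set T := isDyadicTree_dyadicInterval hc.le hc' le_rfl with hT
  obtain ⟨φ, C, ho, hh, hw, hb, hC⟩ := exists_bounded_system S T (by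
    rw [dyadicInterval_one, dyadicInterval_one]
    exact Set.Ico_disjoint_Ico_same)
  have hmem : ∀ n, MemLp (fun x => (φ n x : ℂ)) 2 (bandMeasure Real.pi) := fun n =>
    MemLp.of_bound (Complex.measurable_ofReal.comp (measurable_coe (φ n))).aestronglyMeasurable C
      (Eventually.of_forall fun x => by rw [Complex.norm_real]; exact hb n x)
  set u : ℕ → PW 2 Real.pi := fun n => ofSpectrum _ (hmem n) with hu
  have hhat : ∀ n, (u n).hat =ᵐ[bandMeasure Real.pi] fun x => (φ n x : ℂ) := fun n =>
    hat_ofSpectrum _ _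
  have hinner : ∀ n (f : PW 2 Real.pi),
      inner ℂ (u n) f = ∫ x, f.hat x * (φ n x : ℂ) ∂(bandMeasure Real.pi) := by
    intro n f
    rw [PW.inner_def, L2.inner_def]
    refine integral_congr_ae ?_
    filter_upwards [hhat n] with x hx
    rw [hx, RCLike.inner_apply, Complex.conj_ofReal]
  have hon : Orthonormal ℂ u := by
    rw [orthonormal_iff_ite]
    intro i j
    have h1 : intg (bandMeasure Real.pi) (φ j * φ i) =
        ∫ x, φ j x * φ i x ∂(bandMeasure Real.pi) := rfl
    have h2 : inner ℂ (u i) (u j) =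
        ∫ x, ((φ j x * φ i x : ℝ) : ℂ) ∂(bandMeasure Real.pi) := by
      rw [hinner]
      refine integral_congr_ae ?_
      filter_upwards [hhat j] with x hx
      rw [hx]
      push_cast
      rfl
    rw [h2, integral_complex_ofReal, ← h1, ho]
    by_cases h : i = j
    · simp [h]
    · simp [h, Ne.symm h]
  have hbot : (Submodule.span ℂ (Set.range u))ᗮ = ⊥ := by
    rw [Submodule.eq_bot_iff]
    intro f hf
    have h0 : ∀ n, ∫ x, f.hat x * (φ n x : ℂ) ∂(bandMeasure Real.pi) = 0 := fun n => by
      rw [← hinner]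
      exact (Submodule.mem_orthogonal _ _).1 hf _ (Submodule.subset_span ⟨n, rfl⟩)
    have hspan : ∀ g ∈ Submodule.span ℝ (Set.range φ),
        ∫ x, f.hat x * (g x : ℂ) ∂(bandMeasure Real.pi) = 0 := by
      intro g hg
      induction hg using Submodule.span_induction with
      | mem g hg => obtain ⟨n, rfl⟩ := hg; exact h0 n
      | zero => simp
      | add g g' _ _ h h' =>
        simp only [val_add, Complex.ofReal_add, mul_add]
        rw [integral_add (integrable_mul_coe _ (integrable_hat f) g)
          (integrable_mul_coe _ (integrable_hat f) g'), h, h', add_zero]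
      | smul a g _ h =>
        simp only [val_smul, Complex.ofReal_mul, mul_left_comm _ (a : ℂ)]
        rw [integral_const_mul, h, mul_zero]
    refine eq_zero_of_nodes hc hc' (fun m hm => hspan _ ?_) fun m hm => hspan _ ?_
    · refine Submodule.span_le.2 ?_ (S.node_mem_span_haar m hm)
      rintro _ ⟨k, rfl⟩
      exact hh k
    · refine Submodule.span_le.2 ?_ (T.node_mem_span_walsh m hm)
      rintro _ ⟨k, rfl⟩
      exact hw k
  refine ⟨HilbertBasis.mkOfOrthogonalEqBot hon hbot, φ, C, fun n => ?_, hb, fun N x hx => ?_⟩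
  · rw [HilbertBasis.coe_mkOfOrthogonalEqBot]
    exact hhat n
  · exact hC N x (by rwa [dyadicInterval_one])

/-! ### Expansions in the basis -/

theorem measurement_eq {s : PW 2 Real.pi} {φ : boundedMeasurable ℝ}
    (h : s.hat =ᵐ[bandMeasure Real.pi] fun x => (φ x : ℂ)) (f : PW 1 Real.pi) :
    s.measurement f = ∫ x, f.hat x * (φ x : ℂ) ∂(bandMeasure Real.pi) := by
  rw [PW.measurement, ← PW.integral_bandMeasure_pi]
  refine integral_congr_ae ?_
  filter_upwards [h] with x hx
  rw [hx, Complex.conj_ofReal]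

theorem norm_measurement_le {s : PW 2 Real.pi} {φ : boundedMeasurable ℝ} {C : ℝ}
    (h : s.hat =ᵐ[bandMeasure Real.pi] fun x => (φ x : ℂ)) (hC : ∀ x, |φ x| ≤ C)
    (f : PW 1 Real.pi) : ‖s.measurement f‖ ≤ C * ‖f‖ := by
  rw [measurement_eq h, norm_eq_integral, ← integral_const_mul]
  refine (norm_integral_le_integral_norm _).trans ?_
  refine integral_mono (integrable_mul_coe _ (integrable_hat f) φ).norm
    ((integrable_hat f).norm.const_mul C) fun x => ?_
  simp only
  rw [norm_mul, Complex.norm_real, mul_comm]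
  exact mul_le_mul_of_nonneg_right (hC x) (norm_nonneg _)

/-- The partial sum `∑ n < N, γ_n(f) s_n` of the expansion of `f ∈ PW^1_π`. -/
noncomputable def partialSum (s : ℕ → PW 2 Real.pi) (N : ℕ) (f : PW 1 Real.pi) :
    PW 1 Real.pi :=
  ∑ n ∈ Finset.range N, (s n).measurement f • (s n).toPW1

theorem partialSum_toPW1 (s : HilbertBasis ℕ ℂ (PW 2 Real.pi)) (N : ℕ) (f : PW 2 Real.pi) :
    partialSum s N f.toPW1 = (∑ n ∈ Finset.range N, s.repr f n • s n).toPW1 := by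
  change _ = toPW1ₗ _
  rw [map_sum]
  refine Finset.sum_congr rfl fun n _ => ?_
  rw [map_smul, PW.measurement_toPW1, s.repr_apply_apply]
  rfl

theorem partialSum_sub {s : ℕ → PW 2 Real.pi} {φ : ℕ → boundedMeasurable ℝ}
    (hs : ∀ n, (s n).hat =ᵐ[bandMeasure Real.pi] fun x => (φ n x : ℂ)) (N : ℕ)
    (f g : PW 1 Real.pi) : partialSum s N (f - g) = partialSum s N f - partialSum s N g := by
  rw [partialSum, partialSum, partialSum, ← Finset.sum_sub_distrib]
  refine Finset.sum_congr rfl fun n _ => ?_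
  rw [← sub_smul, measurement_eq (hs n), measurement_eq (hs n), measurement_eq (hs n),
    ← integral_sub (integrable_mul_coe _ (integrable_hat f) _)
      (integrable_mul_coe _ (integrable_hat g) _)]
  congr 1
  refine integral_congr_ae ?_
  filter_upwards [hat_sub f g] with x hx
  rw [hx, sub_mul]

theorem norm_partialSum_le {s : ℕ → PW 2 Real.pi} {φ : ℕ → boundedMeasurable ℝ} {C : ℝ} {G : Set ℝ}
    (hs : ∀ n, (s n).hat =ᵐ[bandMeasure Real.pi] fun x => (φ n x : ℂ))
    (hC : ∀ N, ∀ x ∈ G, l1 (bandMeasure Real.pi) (∑ n ∈ Finset.range N, φ n x • φ n) ≤ C)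
    {f : PW 1 Real.pi} (hf : ∀ᵐ x ∂(bandMeasure Real.pi), x ∉ G → f.hat x = 0) (N : ℕ) :
    ‖partialSum s N f‖ ≤ C * ‖f‖ := by
  rw [norm_eq_integral, norm_eq_integral]
  refine le_trans (le_of_eq ?_) (integral_norm_sum_le _ (hC N) (integrable_hat f) hf)
  have h1 : (partialSum s N f).hat =
      ∑ n ∈ Finset.range N, (s n).measurement f • (s n).toPW1.hat := by
    change PW.hatₗ _ = _
    rw [partialSum, map_sum]
    exact Finset.sum_congr rfl fun n _ => map_smul PW.hatₗ _ _
  have h2 : ∀ᵐ x ∂(bandMeasure Real.pi), ∀ n,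
      ((s n).measurement f • (s n).toPW1.hat : Lp ℂ 1 (bandMeasure Real.pi)) x =
        (s n).measurement f * (φ n x : ℂ) := by
    refine ae_all_iff.2 fun n => ?_
    filter_upwards [Lp.coeFn_smul ((s n).measurement f) (s n).toPW1.hat, hat_toPW1 (s n), hs n]
      with x h1 h2 h3
    rw [h1, Pi.smul_apply, h2, h3, smul_eq_mul]
  refine integral_congr_ae ?_
  rw [h1]
  filter_upwards [Lp.coeFn_fun_finsetSum (Finset.range N)
    (fun n => (s n).measurement f • (s n).toPW1.hat), h2] with x h3 h4
  rw [h3]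
  congr 1
  exact Finset.sum_congr rfl fun n _ => by rw [h4, measurement_eq (hs n)]

/-- `PW^2_π` is dense in `PW^1_π`, with control of the support of the spectrum. -/
theorem exists_toPW1_close {G : Set ℝ} (hG : MeasurableSet G) {f : PW 1 Real.pi}
    (hf : ∀ᵐ x ∂(bandMeasure Real.pi), x ∉ G → f.hat x = 0) {ε : ℝ} (hε : 0 < ε) :
    ∃ g : PW 2 Real.pi, ‖f - g.toPW1‖ < ε ∧
      ∀ᵐ x ∂(bandMeasure Real.pi), x ∉ G → (f - g.toPW1).hat x = 0 := by
  obtain ⟨q, hq, hq1⟩ := (Lp.memLp f.hat).exists_simpleFunc_eLpNorm_sub_lt (by simp)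
    (ε := ENNReal.ofReal ε) (by simpa using hε)
  have hm : MemLp (G.indicator q) 2 (bandMeasure Real.pi) :=
    (q.memLp_of_isFiniteMeasure 2 _).indicator hG
  have hsub : (f - (ofSpectrum _ hm).toPW1).hat =ᵐ[bandMeasure Real.pi]
      G.indicator fun x => f.hat x - q x := by
    filter_upwards [hat_sub f (ofSpectrum _ hm).toPW1, hat_toPW1 (ofSpectrum _ hm),
      hat_ofSpectrum _ hm, hf] with x h1 h2 h3 h4
    rw [h1, h2, h3]
    by_cases hx : x ∈ G
    · simp [hx]
    · simp [hx, h4 hx]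
  refine ⟨ofSpectrum _ hm, ?_, ?_⟩
  · rw [PW.norm_def, Lp.norm_def, eLpNorm_congr_ae hsub]
    refine ENNReal.toReal_lt_of_lt_ofReal (lt_of_le_of_lt ?_ hq)
    exact eLpNorm_indicator_le _
  · filter_upwards [hsub] with x h hx
    rw [h, Set.indicator_of_notMem hx]

/-- The expansion of every `f ∈ PW^1_π` with spectrum supported in `G` converges to `f`: this
holds on the dense subspace `PW^2_π`, and the partial sums are uniformly bounded. -/
theorem tendsto_partialSum {s : HilbertBasis ℕ ℂ (PW 2 Real.pi)}
    {φ : ℕ → boundedMeasurable ℝ} {C : ℝ} {G : Set ℝ} (hG : MeasurableSet G)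
    (hs : ∀ n, (s n).hat =ᵐ[bandMeasure Real.pi] fun x => (φ n x : ℂ))
    (hC : ∀ N, ∀ x ∈ G, l1 (bandMeasure Real.pi) (∑ n ∈ Finset.range N, φ n x • φ n) ≤ C)
    {f : PW 1 Real.pi} (hf : ∀ᵐ x ∂(bandMeasure Real.pi), x ∉ G → f.hat x = 0) :
    Tendsto (fun N => partialSum s N f) atTop (𝓝 f) := by
  rw [Metric.tendsto_atTop]
  intro ε hε
  obtain ⟨g, hg, hg0⟩ := exists_toPW1_close hG hf
    (ε := ε / 2 / (1 + |C|)) (by positivity)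
  have hlim := (s.hasSum_repr g).tendsto_sum_nat
  obtain ⟨N₀, hN₀⟩ := Metric.tendsto_atTop.1 hlim (ε / 2) (by positivity)
  refine ⟨N₀, fun N hN => ?_⟩
  have h1 : ‖partialSum s N g.toPW1 - g.toPW1‖ < ε / 2 := by
    have := hN₀ N hN
    rw [dist_eq_norm] at this
    rw [partialSum_toPW1]
    have e : (∑ n ∈ Finset.range N, s.repr g n • s n).toPW1 - g.toPW1 =
      (∑ n ∈ Finset.range N, s.repr g n • s n - g).toPW1 := rfl
    rw [e]
    exact (norm_toPW1_le _).trans_lt this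
  have h2 : ‖partialSum s N (f - g.toPW1)‖ ≤ |C| * ‖f - g.toPW1‖ :=
    (norm_partialSum_le hs hC hg0 N).trans
      (mul_le_mul_of_nonneg_right (le_abs_self C) (norm_nonneg _))
  have h3 : (1 + |C|) * ‖f - g.toPW1‖ < ε / 2 := by
    rwa [lt_div_iff₀ (by positivity), mul_comm] at hg
  rw [dist_eq_norm]
  have e : partialSum s N f - f = partialSum s N (f - g.toPW1) +
      (partialSum s N g.toPW1 - g.toPW1) - (f - g.toPW1) := by
    rw [partialSum_sub hs]
    abel
  rw [e]
  calc _ ≤ ‖partialSum s N (f - g.toPW1)‖ + ‖partialSum s N g.toPW1 - g.toPW1‖ +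
        ‖f - g.toPW1‖ := (norm_sub_le _ _).trans (add_le_add_left (norm_add_le _ _) _)
    _ < ε := by linarith

end BoundedBasis

open PaleyWiener in
theorem theorem15 (β : ℝ) (hβ₀ : 0 < β) (hβ₁ : β < 1) :
    ∃ s : HilbertBasis ℕ ℂ (PW 2 Real.pi),
      -- the measurement functionals are uniformly bounded
      (∃ Cγ : ℝ, 0 < Cγ ∧ ∀ n : ℕ,
        eLpNorm (s n).hat ∞ (bandMeasure Real.pi) ≤ ENNReal.ofReal Cγ ∧
        ∀ f : PW 1 Real.pi, ‖(s n).measurement f‖ ≤ Cγ * ‖f‖) ∧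
      -- uniform convergence on the real line
      (∀ H : PW 1 Real.pi →L[ℂ] PW 1 Real.pi, IsTimeInvariant H →
        ∀ f : PW 1 Real.pi, (f : ℂ → ℂ) ∈ functions 1 (β * Real.pi) →
          TendstoUniformly
            (fun (N : ℕ) (t : ℝ) =>
              ∑ n ∈ Finset.range N, (s n).measurement f * H (s n).toPW1 t)
            (fun t : ℝ => H f t) atTop) ∧
      -- the uniform bound
      (∃ C : ℝ, 0 < C ∧
        ∀ H : PW 1 Real.pi →L[ℂ] PW 1 Real.pi, IsTimeInvariant H →
          ∀ f : PW 1 Real.pi, (f : ℂ → ℂ) ∈ functions 1 (β * Real.pi) →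
            ∀ (N : ℕ) (t : ℝ),
              ‖∑ n ∈ Finset.range N, (s n).measurement f * H (s n).toPW1 t‖ ≤
                C * ‖H‖ * ‖f‖) := by
  have hπ := Real.pi_pos
  have hlt : β * Real.pi < Real.pi := mul_lt_of_lt_one_left hπ hβ₁
  have hgt : -Real.pi < β * Real.pi := by nlinarith
  obtain ⟨s, φ, C, hs, hb, hC⟩ := BoundedBasis.exists_hilbertBasis_bounded hgt hlt
  have hf0 : ∀ f : PW 1 Real.pi, (f : ℂ → ℂ) ∈ functions 1 (β * Real.pi) →
      ∀ᵐ x ∂(bandMeasure Real.pi), x ∉ Set.Ico (-Real.pi) (β * Real.pi) → f.hat x = 0 := by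
    intro f hf
    -- the endpoint `βπ` of the support is not in the half-open interval, but it is a null set
    have hne : ∀ᵐ x ∂(bandMeasure Real.pi), x ≠ β * Real.pi :=
      ae_bandMeasure_of_ae_restrict (ae_restrict_of_ae (Measure.ae_ne volume _))
    filter_upwards [BoundedBasis.hat_eq_zero_of_mem_functions hlt.le hf, hne] with x h1 h2 hx
    refine h1 fun h => hx ⟨?_, lt_of_le_of_ne h.2 h2⟩
    linarith [h.1]
  have hC0 : 0 ≤ C := (abs_nonneg _).trans (hb 0 0)
  have hsum : ∀ (H : PW 1 Real.pi →L[ℂ] PW 1 Real.pi) (f : PW 1 Real.pi) (N : ℕ) (t : ℝ),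
      ∑ n ∈ Finset.range N, (s n).measurement f * H (s n).toPW1 t =
        H (BoundedBasis.partialSum s N f) t := by
    intro H f N t
    change _ = BoundedBasis.evalₗ (t : ℂ) (H _)
    rw [BoundedBasis.partialSum, map_sum, map_sum]
    refine Finset.sum_congr rfl fun n _ => ?_
    rw [map_smul, map_smul]
    rfl
  -- the constants have to be positive, hence `C + 1`
  refine ⟨s, ⟨C + 1, by linarith, fun n => ⟨?_, fun f => ?_⟩⟩, ?_, C + 1, by linarith, ?_⟩
  · refine eLpNormEssSup_le_of_ae_bound ?_
    filter_upwards [hs n] with x hx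
    rw [hx, Complex.norm_real, Real.norm_eq_abs]
    linarith [hb n x]
  · refine (BoundedBasis.norm_measurement_le (hs n) (hb n) f).trans ?_
    exact mul_le_mul_of_nonneg_right (by linarith) (norm_nonneg _)
  · intro H _ f hf
    have hlim := BoundedBasis.tendsto_partialSum measurableSet_Ico hs hC (hf0 f hf)
    have hlim' := (H.continuous.tendsto f).comp hlim
    rw [Metric.tendstoUniformly_iff]
    intro ε hε
    filter_upwards [Metric.tendsto_nhds.1 hlim' ε hε] with N hN t
    rw [hsum, dist_comm]
    rw [dist_eq_norm] at hN ⊢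
    exact (BoundedBasis.norm_apply_le (H (BoundedBasis.partialSum s N f) - H f) t).trans_lt hN
  · intro H _ f hf N t
    rw [hsum]
    have h1 := BoundedBasis.norm_partialSum_le hs hC (hf0 f hf) N
    calc _ ≤ ‖H (BoundedBasis.partialSum s N f)‖ := BoundedBasis.norm_apply_le _ t
      _ ≤ ‖H‖ * ‖BoundedBasis.partialSum s N f‖ := H.le_opNorm _
      _ ≤ ‖H‖ * ((C + 1) * ‖f‖) := by
          refine mul_le_mul_of_nonneg_left (h1.trans ?_) (norm_nonneg _)
          exact mul_le_mul_of_nonneg_right (by linarith) (norm_nonneg _)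
      _ = (C + 1) * ‖H‖ * ‖f‖ := by ring
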